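/- **Setting.** Let $\mathbb F_q$ be a finite field of characteristic $p$. Let $N,M,K,X,T\ge 0$ be integers with $K\ge 1$. *Storage.* There are $N$ servers and $M$ messages; each message consists of blocks of $K$ symbols of $\mathbb F_q$. For every block the $K$ symbols of each message are encoded, together with $X$ independent uniform noise symbols, by an $[N,K+X]$ MDS code over $\mathbb F_q$, and each server stores one code symbol. The storage must be $X$-secure: the law of what any at most $X$ servers store does not depend on the messages. *Retrieval.* A user wants message $\theta$. The user queries $n\le N$ of the servers in several rounds, with queries that depend on $\theta$ and private randomness. They must be $T$-private: the law of all queries received by any at most $T$ servers does not depend on $\theta$. In each round the $n$ queried servers hold one qudit (of dimension $q$) each of an entangled state that does not depend on the data. Server $i$ computes $(x_i,x_{n+i})\in\mathbb F_q^2$ from its query and its storage, applies $\mathsf X(x_i)\mathsf Z(x_{n+i})$ to its qudit, where $\mathsf X(a)|j\rangle=|j+a\rangle$ and $\mathsf Z(b)|j\rangle=e^{2\pi i\,\mathrm{tr}(bj)/p}|j\rangle$, and sends it to the user, who performs a projective measurement. State and measurement form an *$n$-sum box* with transfer matrix $\mathbf M\in\mathbb F_q^{n\times 2n}$: the outcome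 is $\mathbf y=\mathbf M\mathbf x$ with probability one for every $\mathbf x\in\mathbb F_q^{2n}$. From the outcomes of all rounds the user must recover message $\theta$ without error. The *rate* is the number of $q$-ary symbols of the desired message divided by the total number of downloaded qudits. *QCSA schemes.* Such a scheme is a *QCSA scheme* with parameters $(n,L)$, $2L\le n$, if each message consists of $2L$ blocks $(b,l)\in\{1,2\}\times\{1,\dots,L\}$, there are $K$ rounds, and there are distinct $\alpha_1,\dots,\alpha_n,f_1,\dots,f_L\in\mathbb F_q$ and nonzero $u_1,\dots,u_n$, with $v_j=u_j^{-1}\prod_{i\ne j}(\alpha_j-\alpha_i)^{-1}$, such that the following holds. For $\boldsymbol\beta\in\{\mathbf u,\mathbf v\}$ let $\mathbf Q^{\boldsymbol\beta}$ be the $n\times n$ matrix with rows $\big(\tfrac{\beta_i}{f_1-\alpha_i},\dots,\tfrac{\beta_i}{f_L-\alpha_i},\beta_i,\beta_i\alpha_i,\dots,\beta_i\alpha_i^{n-L-1}\big)$. The transfer matrix of the box is $$\mathbf M=\begin{pmatrix}\mathbf I_L&\mathbf 0_{L\times\lceil n/2\rceil}&\mathbf 0&\mathbf 0&\mathbf 0&\mathbf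 0\\ \mathbf 0&\mathbf 0&\mathbf I_{\lfloor n/2\rfloor-L}&\mathbf 0&\mathbf 0&\mathbf 0\\ \mathbf 0&\mathbf 0&\mathbf 0&\mathbf I_L&\mathbf 0_{L\times\lfloor n/2\rfloor}&\mathbf 0\\ \mathbf 0&\mathbf 0&\mathbf 0&\mathbf 0&\mathbf 0&\mathbf I_{\lceil n/2\rceil-L}\end{pmatrix}\begin{pmatrix}\mathbf Q^{\mathbf u}&\mathbf 0\\ \mathbf 0&\mathbf Q^{\mathbf v}\end{pmatrix}^{-1},$$ and in round $\kappa$ the inputs are $x_i=u_iA^1_i$, $x_{n+i}=v_iA^2_i$ with $$A^b_i=\sum_{l=1}^{L}\frac{W_{b,l,\kappa}}{f_l-\alpha_i}+\sum_{j=0}^{n-L-1}\alpha_i^{j}\,\nu^b_j+\sum_{l=1}^{L}\sum_{k<\kappa}\frac{W_{b,l,k}}{(f_l-\alpha_i)^{\kappa-k+1}},$$ where $W_{b,l,k}$ is the $k$-th symbol of block $(b,l)$ of the desired message and the $\nu^b_j\in\mathbb F_q$ are arbitrary interference terms. **Statement.** Put $I=X+T+K-1$. Suppose that $N>I\ge 1$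 and $q\ge N+\min\{N-I,\,I\}$. Then for some $n\le N$ and $L$ with $n-L=I$ there is an MDS-coded, $X$-secure, $T$-private, zero-error QCSA scheme with parameters $(n,L)$ for the $N$ servers and $M$ messages over $\mathbb F_q$, whose rate is $$R_{\mathsf Q}=\min\Big\{1,\;2\Big(1-\frac{X+T+K-1}{N}\Big)\Big\},$$ that is, the user recovers $N R_{\mathsf Q}$ desired $q$-ary symbols per $N$ downloaded qudits. -/

import Mathlib

open Matrix

universe u

noncomputable section

namespace QCSA

/-! ### Qudits, Weyl operators, measurements -/

section Quantum

variable (p : ℕ) [Fact p.Prime] {F : Type u} [Field F] [Fintype F] [DecidableEq F]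
  [Algebra (ZMod p) F]

/-- `ω ^ (tr x)` with `ω = exp (2πi / p)` and `tr : 𝔽_q → 𝔽_p` the trace
(`ZMod.stdAddChar j = exp (2πi j / p)`). -/
def phase (x : F) : ℂ :=
  ZMod.stdAddChar (Algebra.trace (ZMod p) F x)

/-- The gate `X(a) = ∑ j, |j + a⟩⟨j|` on one qudit. -/
def gateX (a : F) : Matrix F F ℂ :=
  Matrix.of fun i j => if i = j + a then 1 else 0

/-- The gate `Z(b) = ∑ j, ω ^ (tr (b j)) |j⟩⟨j|` on one qudit. -/
def gateZ (b : F) : Matrix F F ℂ :=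
  Matrix.diagonal fun j => phase p (b * j)

/-- The tensor product of `n` one-qudit operators; the computational basis of `n` qudits is
indexed by `Fin n → F`. -/
def tensorOp {n : ℕ} (A : Fin n → Matrix F F ℂ) : Matrix (Fin n → F) (Fin n → F) ℂ :=
  Matrix.of fun s t => ∏ i, A i (s i) (t i)

/-- The operator applied jointly by `n` transmitters: transmitter `i` holds the two inputs
`x (inl i)` and `x (inr i)` and applies `X(x (inl i)) Z(x (inr i))` to its own qudit. -/
def weyl {n : ℕ} (x : Fin n ⊕ Fin n → F) : Matrix (Fin n → F) (Fin n → F) ℂ :=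
  tensorOp fun i => gateX (x (Sum.inl i)) * gateZ p (x (Sum.inr i))

/-- A projective measurement with outcomes in `O`. -/
structure IsPVM {ι O : Type*} [Fintype ι] [DecidableEq ι] [Fintype O]
    (P : O → Matrix ι ι ℂ) : Prop where
  hermitian : ∀ y, (P y).IsHermitian
  idempotent : ∀ y, P y * P y = P y
  orthogonal : ∀ y z, y ≠ z → P y * P z = 0
  complete : ∑ y, P y = 1

/-- Born rule: the probability `⟨φ| P_y |φ⟩` of the outcome `y` in the pure state `φ`. -/
def outcomeProb {ι O : Type*} [Fintype ι] (P : O → Matrix ι ι ℂ) (φ : ι → ℂ) (y : O) : ℝ :=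
  (star φ ⬝ᵥ (P y *ᵥ φ)).re

variable (F) in
/-- An `n`-sum box over `𝔽_q`: an `n`-qudit state shared by `n` transmitters (one qudit each),
and a measurement of the receiver on the `n` qudits, such that after the transmitters have applied
their local gates `X(x_i) Z(x_{n+i})` the outcome is, with probability one, `y = M x`. -/
structure SumBox (n : ℕ) where
  state : (Fin n → F) → ℂ
  state_unit : star state ⬝ᵥ state = 1
  pvm : (Fin n → F) → Matrix (Fin n → F) (Fin n → F) ℂ
  isPVM : IsPVM pvm
  transfer : Matrix (Fin n) (Fin n ⊕ Fin n) F
  output : ∀ x : Fin n ⊕ Fin n → F,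
    outcomeProb pvm (weyl p x *ᵥ state) (transfer *ᵥ x) = 1

end Quantum

/-! ### The QCSA transfer matrix -/

section QCSAMatrix

variable {F : Type u} [Field F]

/-- The `n × n` matrix `QCSA_{n,L}(α, β, f)`: row `i` is
`β_i / (f_1 - α_i), …, β_i / (f_L - α_i), β_i, β_i α_i, …, β_i α_i ^ (n - L - 1)`. -/
def qcsaMatrix {n L : ℕ} (α β : Fin n → F) (f : Fin L → F) : Matrix (Fin n) (Fin n) F :=
  Matrix.of fun i j =>
    if h : (j : ℕ) < L then β i / (f ⟨j, h⟩ - α i) else β i * α i ^ ((j : ℕ) - L)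

/-- `v_j = (u_j ∏_{i ≠ j} (α_j - α_i))⁻¹`. -/
def dualMultiplier {n : ℕ} (α u : Fin n → F) (j : Fin n) : F :=
  (u j)⁻¹ * (∏ i ∈ Finset.univ.erase j, (α j - α i))⁻¹

/-- The columns of `diag(Q^u, Q^v)` kept by the rows of the selection matrix, in this order:
the first `L` and the last `⌊n/2⌋ - L` of the first block, then
the first `L` and the last `⌈n/2⌉ - L` of the second block. -/
def selectedColumn (n L : ℕ) (r : Fin n) : Fin n ⊕ Fin n :=
  if h : (r : ℕ) < n / 2 then
    if (r : ℕ) < L then Sum.inl r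
    else Sum.inl ⟨r + (n - n / 2), by omega⟩
  else
    if (r : ℕ) < n / 2 + L then Sum.inr ⟨r - n / 2, by omega⟩
    else Sum.inr r

/-- The `0/1` matrix with blocks `(I_L, 0, 0 | 0, 0, 0)`, `(0, 0, I_{⌊n/2⌋-L} | 0, 0, 0)`,
`(0, 0, 0 | I_L, 0, 0)`, `(0, 0, 0 | 0, 0, I_{⌈n/2⌉-L})`. -/
def selectionMatrix (n L : ℕ) : Matrix (Fin n) (Fin n ⊕ Fin n) F :=
  Matrix.of fun r c => if c = selectedColumn n L r then 1 else 0

/-- `M_QCSA = selection * diag(Q^u, Q^v)⁻¹`. -/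
def qcsaTransfer {n L : ℕ} (α u v : Fin n → F) (f : Fin L → F) :
    Matrix (Fin n) (Fin n ⊕ Fin n) F :=
  selectionMatrix n L * (Matrix.fromBlocks (qcsaMatrix α u f) 0 0 (qcsaMatrix α v f))⁻¹

end QCSAMatrix

/-! ### Quantum MDS-coded secure and private information retrieval -/

/-- The data of a quantum retrieval scheme for `M` messages stored at `N` servers with
`X` noise symbols per `K` message symbols.

Each message consists of `K` symbols of `𝔽_q` for every block `j : ι`. In each of `R` rounds the
user sends a query to each of `n` of the servers; the `n` queried servers share a fresh copy of the
state of an `n`-sum box, each of them computes its two inputs to the box from the query that it has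
received and from its own storage and sends its qudit to the user, who measures the
`n` qudits. -/
structure Scheme (p : ℕ) [Fact p.Prime] (F : Type u) [Field F] [Fintype F] [DecidableEq F]
    [Algebra (ZMod p) F] (N M K X n R : ℕ) (ι : Type) where
  /-- for each block, the generator matrix of the code that maps `K` message symbols and
  `X` noise symbols to one symbol for each of the `N` servers -/
  code : ι → Matrix (Fin N) (Fin K ⊕ Fin X) F
  /-- the servers that are queried -/
  server : Fin n ↪ Fin N
  /-- the private randomness of the user, uniform on a finite set -/
  Rand : Type u
  [randFintype : Fintype Rand]
  [randNonempty : Nonempty Rand]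
  Query : Type u
  /-- `query κ θ ρ i` is sent in round `κ` to the `i`-th queried server if message `θ` is desired -/
  query : Fin R → Fin M → Rand → Fin n → Query
  /-- `answer κ i Q s` are the two inputs of the `i`-th queried server to the box in round `κ`, if
  it received the query `Q` and stores `s` -/
  answer : Fin R → Fin n → Query → (Fin M → ι → F) → F × F
  box : SumBox p F n
  /-- the desired message as computed by the user from the measurement outcomes of all rounds -/
  decode : Fin M → Rand → (Fin R → Fin n → F) → ι → Fin K → F

namespace Scheme

attribute [instance] Scheme.randFintype Scheme.randNonempty

variable {p : ℕ} [Fact p.Prime] {F : Type u} [Field F] [Fintype F] [DecidableEq F]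
  [Algebra (ZMod p) F] {N M K X n R : ℕ} {ι : Type}

/-- What server `s` stores: for every message and every block one code symbol. -/
def storage (S : Scheme p F N M K X n R ι) (W : Fin M → ι → Fin K → F)
    (Z : Fin M → ι → Fin X → F) (s : Fin N) : Fin M → ι → F :=
  fun m j => ∑ k, S.code j s (Sum.inl k) * W m j k + ∑ x, S.code j s (Sum.inr x) * Z m j x

/-- The inputs to the `n`-sum box in round `κ`. -/
def input (S : Scheme p F N M K X n R ι) (W : Fin M → ι → Fin K → F)
    (Z : Fin M → ι → Fin X → F) (θ : Fin M) (ρ : S.Rand) (κ : Fin R) : Fin n ⊕ Fin n → F :=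
  Sum.elim
    (fun i => (S.answer κ i (S.query κ θ ρ i) (S.storage W Z (S.server i))).1)
    (fun i => (S.answer κ i (S.query κ θ ρ i) (S.storage W Z (S.server i))).2)

/-- The codes used for storage are `[N, K + X]` MDS codes: any `K + X` of the `N` code symbols
determine the `K + X` encoded symbols. -/
def IsMDSCoded (S : Scheme p F N M K X n R ι) : Prop :=
  K + X ≤ N ∧ ∀ (j : ι) (e : Fin K ⊕ Fin X → Fin N), Function.Injective e →
    ((S.code j).submatrix e id).det ≠ 0

/-- `X`-security: if the noise is uniform, then the law of what any at most `X` servers store does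
not depend on the messages. -/
def IsSecure [Fintype ι] [DecidableEq ι] (S : Scheme p F N M K X n R ι) : Prop :=
  ∀ C : Finset (Fin N), C.card ≤ X → ∀ W W' : Fin M → ι → Fin K → F,
    (PMF.uniformOfFintype (Fin M → ι → Fin X → F)).map
        (fun Z => fun s : C => S.storage W Z s) =
      (PMF.uniformOfFintype (Fin M → ι → Fin X → F)).map
        (fun Z => fun s : C => S.storage W' Z s)

/-- `T`-privacy: the law of all the queries that any at most `T` servers receive does not depend
on the index of the desired message. -/
def IsPrivate (S : Scheme p F N M K X n R ι) (T : ℕ) : Prop :=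
  ∀ C : Finset (Fin N), C.card ≤ T → ∀ θ θ' : Fin M,
    (PMF.uniformOfFintype S.Rand).map
        (fun ρ => fun (κ : Fin R) (i : {i : Fin n // S.server i ∈ C}) => S.query κ θ ρ i) =
      (PMF.uniformOfFintype S.Rand).map
        (fun ρ => fun (κ : Fin R) (i : {i : Fin n // S.server i ∈ C}) => S.query κ θ' ρ i)

/-- Zero-error decoding: whatever outcomes of nonzero probability are measured, the user computes
the desired message. -/
def IsCorrect (S : Scheme p F N M K X n R ι) : Prop :=
  ∀ (W : Fin M → ι → Fin K → F) (Z : Fin M → ι → Fin X → F) (θ : Fin M) (ρ : S.Rand)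
    (y : Fin R → Fin n → F),
    (∀ κ, outcomeProb S.box.pvm (weyl p (S.input W Z θ ρ κ) *ᵥ S.box.state) (y κ) ≠ 0) →
      S.decode θ ρ y = W θ

/-- The number of desired `q`-ary symbols per downloaded `q`-dimensional qudit: the message has
`|ι| K` symbols, and `n` qudits are downloaded in each of the `R` rounds. -/
def rate [Fintype ι] (_S : Scheme p F N M K X n R ι) : ℝ :=
  ((Fintype.card ι * K : ℕ) : ℝ) / ((R * n : ℕ) : ℝ)

/-- The scheme is a QCSA scheme with `L` desired symbols in each of two instances and in each of
`K` rounds: its box has the transfer matrix `M_QCSA`, and in round `κ` the server `i` applies the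
inputs `u_i A^1_i` and `v_i A^2_i`, where the answers `A^1`, `A^2` of the two instances have the
Cauchy-Vandermonde form: the desired symbols of round `κ` are along the Cauchy terms
`1 / (f_l - α_i)`, the interference `ν` is along the Vandermonde terms `1, α_i, …, α_i^(n-L-1)`,
and the remaining part involves only desired symbols of earlier rounds. -/
def IsQCSA {L : ℕ} (S : Scheme p F N M K X n K (Fin 2 × Fin L)) : Prop :=
  2 * L ≤ n ∧ ∃ (α u v : Fin n → F) (f : Fin L → F),
    Function.Injective (Sum.elim α f) ∧ (∀ i, u i ≠ 0) ∧ v = dualMultiplier α u ∧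
    S.box.transfer = qcsaTransfer α u v f ∧
    ∀ (W : Fin M → Fin 2 × Fin L → Fin K → F) (Z : Fin M → Fin 2 × Fin L → Fin X → F)
      (θ : Fin M) (ρ : S.Rand) (κ : Fin K),
      ∃ (A : Fin 2 → Fin n → F) (ν : Fin 2 → Fin (n - L) → F),
        (∀ b i, A b i =
          ∑ l, 1 / (f l - α i) * W θ (b, l) κ
            + ∑ j : Fin (n - L), α i ^ (j : ℕ) * ν b j
            + ∑ l, ∑ k ∈ Finset.univ.filter (· < κ),
                1 / (f l - α i) ^ ((κ : ℕ) - (k : ℕ) + 1) * W θ (b, l) k) ∧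
        S.input W Z θ ρ κ = Sum.elim (fun i => u i * A 0 i) (fun i => v i * A 1 i)

end Scheme

end QCSA

end

noncomputable section

namespace QCSA

/-! ### Weyl operators on code states; sum boxes of CSS type. -/

section Box

variable (p : ℕ) [Fact p.Prime] {F : Type u} [Field F]
  [Algebra (ZMod p) F]

/-! The proof combines a quantum fact, an algebraic fact and a classical retrieval scheme.

Quantum: take the uniform superposition of the words of a linear code `V`. Two Weyl gates send it to
the same state up to a phase if their arguments differ by an element of `V × Vᗮ`, and to orthogonal
states otherwise. So any surjective transfer matrix with kernel `V × Vᗮ` is realized by measuring in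
the basis of Weyl translates, one for each coset (`cssBox`).

Algebra: the Cauchy–Vandermonde matrices are invertible, and the coordinates that the QCSA matrix
discards in its two blocks are those of the first `⌈n/2⌉` and the first `⌊n/2⌋` Vandermonde columns.
The discarded columns span generalized Reed–Solomon codes with multipliers `u` and `v`, which are
dual because the dimensions add up to `n` and `v` is the dual multiplier. Hence the kernel has the
required form (`qcsaTransfer_mulVec_eq_zero_iff`).

Retrieval: write `d = f_l - α_i`. Storage is a polynomial in `d` whose coefficients are `K` message
symbols followed by `X` noise symbols. The query in round `κ` is the indicator of `θ` plus `d ^ (κ +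
1)` times a random polynomial of degree below `T`. After division of the query by `d ^ (κ + 1)`, its
product with the storage has as polar part the desired symbols of rounds up to `κ`, with the new one
at `1 / d`; everything else is a polynomial of degree below `I = X + T + K - 1`, which fits into the
`n - L` Vandermonde columns (`csaQuery_mul_storage_sub_mem`). Rounds are decoded successively
(`IsOutcome.eq`).

With `L = min (N - I) I` and `n = L + I`, the rate `2L / (L + I)` is the claimed one, and `N + L ≤
q` provides the evaluation points. -/

theorem phase_zero : phase p (0 : F) = 1 := by
  simp [phase]

theorem phase_add (x y : F) : phase p (x + y) = phase p x * phase p y := by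
  simp [phase, AddChar.map_add_eq_mul]

theorem star_phase (x : F) : star (phase p x) = phase p (-x) := by
  simp only [phase, map_neg, AddChar.map_neg_eq_conj]
  rfl

theorem star_phase_mul_phase (x y : F) : star (phase p x) * phase p y = phase p (y - x) := by
  rw [star_phase, ← phase_add]
  congr 1
  ring

theorem prod_phase {κ : Type*} (s : Finset κ) (f : κ → F) :
    ∏ i ∈ s, phase p (f i) = phase p (∑ i ∈ s, f i) := by
  classical
  induction s using Finset.induction_on with
  | empty => simp [phase_zero]
  | insert a s ha ih => rw [Finset.prod_insert ha, Finset.sum_insert ha, ih, phase_add]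

variable {n : ℕ}

open Classical in
/-- The uniform superposition `|V|^(-1/2) ∑ c ∈ V, |c⟩` of the words of a linear code `V`. -/
def codeState (V : Submodule F (Fin n → F)) (t : Fin n → F) : ℂ :=
  if t ∈ V then (((Real.sqrt (Nat.card V))⁻¹ : ℝ) : ℂ) else 0

theorem star_codeState (V : Submodule F (Fin n → F)) (t : Fin n → F) :
    star (codeState V t) = codeState V t := by
  unfold codeState
  split_ifs <;> simp

theorem codeState_of_notMem (V : Submodule F (Fin n → F)) {t : Fin n → F} (ht : t ∉ V) :
    codeState V t = 0 := by
  simp [codeState, ht]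

theorem codeState_add (V : Submodule F (Fin n → F)) (t : Fin n → F) {v : Fin n → F} (hv : v ∈ V) :
    codeState V (t + v) = codeState V t := by
  classical
  rw [codeState, codeState]
  exact if_congr (V.add_mem_iff_left hv) rfl rfl

variable [Fintype F]

/-- Nondegeneracy of the trace form, together with injectivity of the standard character of `ZMod
p`. -/
theorem exists_phase_mul_ne_one {a : F} (ha : a ≠ 0) : ∃ b : F, phase p (b * a) ≠ 1 := by
  by_contra! h
  refine ha ((traceForm_nondegenerate (ZMod p) F).1 a fun b => ?_)
  have hb := h b
  rw [phase, ← (ZMod.stdAddChar (N := p)).map_zero_eq_one, ZMod.injective_stdAddChar.eq_iff] at hb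
  rw [Algebra.traceForm_apply, mul_comm, hb]

theorem sum_sub_right (a : Fin n → F) (g : (Fin n → F) → ℂ) : ∑ s, g (s - a) = ∑ t, g t :=
  Equiv.sum_comp (Equiv.subRight a) g

theorem codeState_sq (V : Submodule F (Fin n → F)) {t : Fin n → F} (ht : t ∈ V) :
    codeState V t * codeState V t = ((Nat.card V : ℂ))⁻¹ := by
  classical
  rw [codeState, if_pos ht, ← Complex.ofReal_mul, ← mul_inv,
    Real.mul_self_sqrt (Nat.cast_nonneg _)]
  simp

open Classical in
theorem sum_codeState_sq_mul (V : Submodule F (Fin n → F)) (g : (Fin n → F) → ℂ) :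
    ∑ t, codeState V t * codeState V t * g t = (Nat.card V : ℂ)⁻¹ * ∑ v : V, g v := by
  classical
  rw [Finset.mul_sum, ← Finset.sum_filter_add_sum_filter_not Finset.univ (· ∈ V)]
  rw [Finset.sum_eq_zero (s := Finset.univ.filter fun t => ¬ t ∈ V) fun t ht => by
    rw [codeState_of_notMem V (Finset.mem_filter.1 ht).2, zero_mul, zero_mul], add_zero]
  rw [Finset.sum_subtype (p := (· ∈ V)) _ (by simp)]
  exact Finset.sum_congr rfl fun v _ => by rw [codeState_sq V v.2]

open Classical in
-- Translating the sum by a suitable multiple of `c` multiplies it by a phase different from `1`.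
theorem sum_phase_dotProduct_eq_zero (V : Submodule F (Fin n → F)) {b : Fin n → F}
    (hb : ∃ c ∈ V, b ⬝ᵥ c ≠ 0) : ∑ v : V, phase p (b ⬝ᵥ (v : Fin n → F)) = 0 := by
  obtain ⟨c, hc, hbc⟩ := hb
  obtain ⟨r, hr⟩ := exists_phase_mul_ne_one p hbc
  refine eq_zero_of_mul_eq_self_left hr ?_
  rw [Finset.mul_sum]
  refine Fintype.sum_equiv (Equiv.addLeft ⟨r • c, V.smul_mem r hc⟩) _ _ fun v => ?_
  rw [← phase_add]
  simp [dotProduct_add, dotProduct_smul]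

variable [DecidableEq F]

theorem weyl_apply (x : Fin n ⊕ Fin n → F) (s t : Fin n → F) :
    weyl p x s t = if t = s - x ∘ Sum.inl then phase p ((x ∘ Sum.inr) ⬝ᵥ t) else 0 := by
  have h : ∀ i, (gateX (x (Sum.inl i)) * gateZ p (x (Sum.inr i))) (s i) (t i) =
      if t i = s i - x (Sum.inl i) then phase p (x (Sum.inr i) * t i) else 0 := fun i => by
    rw [gateZ, Matrix.mul_diagonal]
    simp [gateX, eq_sub_iff_add_eq, eq_comm]
  simp only [weyl, tensorOp, Matrix.of_apply, h]
  split_ifs with hst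
  · rw [dotProduct, ← prod_phase]
    refine Finset.prod_congr rfl fun i _ => ?_
    exact if_pos (congrFun hst i)
  · obtain ⟨i, hi⟩ := Function.ne_iff.1 hst
    exact Finset.prod_eq_zero (Finset.mem_univ i) (if_neg hi)

theorem weyl_mulVec (x : Fin n ⊕ Fin n → F) (φ : (Fin n → F) → ℂ) (s : Fin n → F) :
    (weyl p x *ᵥ φ) s =
      phase p ((x ∘ Sum.inr) ⬝ᵥ (s - x ∘ Sum.inl)) * φ (s - x ∘ Sum.inl) := by
  simp [Matrix.mulVec, dotProduct, weyl_apply]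

theorem weyl_codeState_unit (V : Submodule F (Fin n → F)) (x : Fin n ⊕ Fin n → F) :
    star (weyl p x *ᵥ codeState V) ⬝ᵥ (weyl p x *ᵥ codeState V) = 1 := by
  classical
  have h : ∀ s, star (weyl p x *ᵥ codeState V) s * (weyl p x *ᵥ codeState V) s =
      codeState V (s - x ∘ Sum.inl) * codeState V (s - x ∘ Sum.inl) * 1 := fun s => by
    rw [Pi.star_apply, weyl_mulVec, star_mul, star_codeState]
    linear_combination (codeState V (s - x ∘ Sum.inl) * codeState V (s - x ∘ Sum.inl)) *
      (star_phase_mul_phase p ((x ∘ Sum.inr) ⬝ᵥ (s - x ∘ Sum.inl)) _).trans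
        (by rw [sub_self, phase_zero])
  rw [dotProduct, Finset.sum_congr rfl fun s _ => h s,
    sum_sub_right (x ∘ Sum.inl) fun t => codeState V t * codeState V t * 1,
    sum_codeState_sq_mul, Finset.sum_const, Finset.card_univ, ← Nat.card_eq_fintype_card]
  simp

/-- Gates that differ by an element of the stabilizer give the same state up to a phase. -/
theorem weyl_codeState_eq_smul (V : Submodule F (Fin n → F)) (x x' : Fin n ⊕ Fin n → F)
    (h₁ : (x - x') ∘ Sum.inl ∈ V) (h₂ : ∀ c ∈ V, ((x - x') ∘ Sum.inr) ⬝ᵥ c = 0) :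
    ∃ z : F, weyl p x *ᵥ codeState V = phase p z • (weyl p x' *ᵥ codeState V) := by
  -- On the support `s - x ∘ Sum.inl ∈ V`, the `Z`-part of `x` may be replaced by that of `x'`; the
  -- phases then differ by this constant, independent of `s`.
  refine ⟨(x' ∘ Sum.inr) ⬝ᵥ (x' ∘ Sum.inl - x ∘ Sum.inl), funext fun s => ?_⟩
  have hs : s - x' ∘ Sum.inl = (s - x ∘ Sum.inl) + (x - x') ∘ Sum.inl := by
    ext i
    simp
  rw [Pi.smul_apply, smul_eq_mul, weyl_mulVec, weyl_mulVec, ← mul_assoc, ← phase_add]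
  by_cases hV : s - x ∘ Sum.inl ∈ V
  · have hb := h₂ _ hV
    have hx : (x - x') ∘ Sum.inr = x ∘ Sum.inr - x' ∘ Sum.inr := rfl
    rw [hx, sub_dotProduct, sub_eq_zero] at hb
    rw [hb, ← dotProduct_add]
    congr 1
    · congr 2
      ext i
      simp
    · rw [hs, codeState_add V _ h₁]
  · rw [hs, codeState_add V _ h₁, codeState_of_notMem V hV, mul_zero, mul_zero]

/-- Gates that differ by an element outside the stabilizer give orthogonal states. -/
theorem weyl_codeState_orthogonal (V : Submodule F (Fin n → F)) (x x' : Fin n ⊕ Fin n → F)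
    (h : ¬ ((x - x') ∘ Sum.inl ∈ V ∧ ∀ c ∈ V, ((x - x') ∘ Sum.inr) ⬝ᵥ c = 0)) :
    star (weyl p x' *ᵥ codeState V) ⬝ᵥ (weyl p x *ᵥ codeState V) = 0 := by
  have hs : ∀ s, s - x' ∘ Sum.inl = (s - x ∘ Sum.inl) + (x - x') ∘ Sum.inl := fun s => by
    ext i
    simp
  by_cases h₁ : (x - x') ∘ Sum.inl ∈ V
  · have h₂ : ∃ c ∈ V, ((x - x') ∘ Sum.inr) ⬝ᵥ c ≠ 0 := by
      by_contra! h₂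
      exact h ⟨h₁, h₂⟩
    -- Equal supports: the inner product is a constant phase times the average over `V` of a
    -- nontrivial character.
    have hterm : ∀ s, star (weyl p x' *ᵥ codeState V) s * (weyl p x *ᵥ codeState V) s =
        codeState V (s - x ∘ Sum.inl) * codeState V (s - x ∘ Sum.inl) *
          (phase p (-((x' ∘ Sum.inr) ⬝ᵥ ((x - x') ∘ Sum.inl))) *
            phase p (((x - x') ∘ Sum.inr) ⬝ᵥ (s - x ∘ Sum.inl))) := fun s => by
      rw [Pi.star_apply, weyl_mulVec, weyl_mulVec, star_mul, star_codeState, ← phase_add]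
      have hx : (x - x') ∘ Sum.inr = x ∘ Sum.inr - x' ∘ Sum.inr := rfl
      have hph := star_phase_mul_phase p ((x' ∘ Sum.inr) ⬝ᵥ (s - x' ∘ Sum.inl))
        ((x ∘ Sum.inr) ⬝ᵥ (s - x ∘ Sum.inl))
      have harg : (x ∘ Sum.inr) ⬝ᵥ (s - x ∘ Sum.inl) - (x' ∘ Sum.inr) ⬝ᵥ (s - x' ∘ Sum.inl) =
          -((x' ∘ Sum.inr) ⬝ᵥ ((x - x') ∘ Sum.inl)) +
            ((x - x') ∘ Sum.inr) ⬝ᵥ (s - x ∘ Sum.inl) := by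
        rw [hs, dotProduct_add, hx, sub_dotProduct]
        ring
      rw [harg] at hph
      rw [← hph, show codeState V (s - x' ∘ Sum.inl) = codeState V (s - x ∘ Sum.inl) by
        rw [hs, codeState_add V _ h₁]]
      ring
    rw [dotProduct, Finset.sum_congr rfl fun s _ => hterm s,
      sum_sub_right (x ∘ Sum.inl) fun t => codeState V t * codeState V t *
        (phase p (-((x' ∘ Sum.inr) ⬝ᵥ ((x - x') ∘ Sum.inl))) *
            phase p (((x - x') ∘ Sum.inr) ⬝ᵥ t)),
      sum_codeState_sq_mul, ← Finset.mul_sum, sum_phase_dotProduct_eq_zero p V h₂]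
    simp
  -- The two states are supported on different cosets of `V`.
  · refine Finset.sum_eq_zero fun s _ => ?_
    rw [Pi.star_apply, weyl_mulVec, weyl_mulVec]
    by_cases hV : s - x ∘ Sum.inl ∈ V
    · have hV' : s - x' ∘ Sum.inl ∉ V := fun h' => h₁ (by
        rw [hs] at h'
        exact (V.add_mem_iff_right hV).1 h')
      rw [codeState_of_notMem V hV']
      simp
    · rw [codeState_of_notMem V hV]
      simp

/-- The measurement in an orthonormal basis. -/
theorem isPVM_of_orthonormal {ι : Type*} [Fintype ι] [DecidableEq ι] (ψ : ι → ι → ℂ)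
    (h : ∀ y z, star (ψ y) ⬝ᵥ ψ z = if y = z then 1 else 0) :
    IsPVM fun y => vecMulVec (ψ y) (star (ψ y)) where
  hermitian y := by
    ext s t
    simp [vecMulVec_apply, mul_comm]
  idempotent y := by
    rw [vecMulVec_mul_vecMulVec, h, if_pos rfl]
    simp
  orthogonal y z hyz := by
    rw [vecMulVec_mul_vecMulVec, h, if_neg hyz]
    simp
  complete := by
    have hU : (Matrix.of fun s y => ψ y s)ᴴ * (Matrix.of fun s y => ψ y s) = 1 := by
      ext y z
      rw [Matrix.one_apply, ← h y z]
      rfl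
    -- There are as many vectors as dimensions, so orthonormality already gives completeness.
    rw [mul_eq_one_comm] at hU
    rw [← hU]
    ext s t
    simp [Matrix.sum_apply, vecMulVec_apply, Matrix.mul_apply]

theorem outcomeProb_vecMulVec {ι O : Type*} [Fintype ι] (ψ : O → ι → ℂ) (φ : ι → ℂ) (y : O) :
    outcomeProb (fun y => vecMulVec (ψ y) (star (ψ y))) φ y =
      (star (star (ψ y) ⬝ᵥ φ) * (star (ψ y) ⬝ᵥ φ)).re := by
  rw [outcomeProb]
  congr 1
  rw [vecMulVec_mulVec, dotProduct_comm, star_dotProduct]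
  simp [mul_comm, dotProduct_comm]

/-- A sum box whose transfer matrix has the kernel `V × Vᗮ`: the shared state is the code state
of `V` and the measurement is in the basis of its Weyl translates. -/
def cssBox (V : Submodule F (Fin n → F)) (A : Matrix (Fin n) (Fin n ⊕ Fin n) F)
    (hsurj : Function.Surjective A.mulVec)
    (hker : ∀ x, A *ᵥ x = 0 ↔ x ∘ Sum.inl ∈ V ∧ ∀ c ∈ V, (x ∘ Sum.inr) ⬝ᵥ c = 0) :
    SumBox p F n where
  state := codeState V
  state_unit := by
    have h := weyl_codeState_unit p V 0
    have h0 : weyl p (0 : Fin n ⊕ Fin n → F) *ᵥ codeState V = codeState V := by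
      ext s
      rw [weyl_mulVec]
      have h1 : (0 : Fin n ⊕ Fin n → F) ∘ Sum.inl = 0 := rfl
      have h2 : (0 : Fin n ⊕ Fin n → F) ∘ Sum.inr = 0 := rfl
      rw [h1, h2, zero_dotProduct, phase_zero, sub_zero, one_mul]
    rwa [h0] at h
  -- `surjInv` picks a representative of each coset of the kernel; another choice changes the vector
  -- only by a phase.
  pvm y := vecMulVec (weyl p (Function.surjInv hsurj y) *ᵥ codeState V)
    (star (weyl p (Function.surjInv hsurj y) *ᵥ codeState V))
  isPVM := by
    refine isPVM_of_orthonormal (fun y => weyl p (Function.surjInv hsurj y) *ᵥ codeState V)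
      fun y z => ?_
    split_ifs with hyz
    · rw [hyz, weyl_codeState_unit]
    · refine weyl_codeState_orthogonal p V _ _ fun h => hyz ?_
      rw [← hker, mulVec_sub, sub_eq_zero] at h
      exact (Function.surjInv_eq hsurj y).symm.trans
        (h.symm.trans (Function.surjInv_eq hsurj z))
  transfer := A
  output x := by
    rw [outcomeProb_vecMulVec fun y => weyl p (Function.surjInv hsurj y) *ᵥ codeState V]
    have h : A *ᵥ (x - Function.surjInv hsurj (A *ᵥ x)) = 0 := by
      rw [mulVec_sub, sub_eq_zero]
      exact (Function.surjInv_eq hsurj (A *ᵥ x)).symm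
    obtain ⟨h₁, h₂⟩ := (hker _).1 h
    obtain ⟨z, hz⟩ := weyl_codeState_eq_smul p V _ _ h₁ h₂
    rw [hz, dotProduct_smul, weyl_codeState_unit, smul_eq_mul, mul_one, star_phase_mul_phase,
      sub_self, phase_zero, Complex.one_re]

open scoped ComplexOrder in
/-- Of an `n`-sum box no outcome but `M x` has a nonzero probability. -/
theorem SumBox.eq_of_outcomeProb_ne_zero (B : SumBox p F n) (x : Fin n ⊕ Fin n → F)
    (hx : star (weyl p x *ᵥ B.state) ⬝ᵥ (weyl p x *ᵥ B.state) = 1) {y : Fin n → F}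
    (hy : outcomeProb B.pvm (weyl p x *ᵥ B.state) y ≠ 0) : y = B.transfer *ᵥ x := by
  by_contra hne
  set φ := weyl p x *ᵥ B.state
  have hnonneg : ∀ z, 0 ≤ outcomeProb B.pvm φ z := fun z => by
    -- The outcome probability is the squared norm of the projected state.
    have : star φ ⬝ᵥ (B.pvm z *ᵥ φ) = star (B.pvm z *ᵥ φ) ⬝ᵥ (B.pvm z *ᵥ φ) := by
      rw [star_mulVec (B.pvm z), ← dotProduct_mulVec, mulVec_mulVec φ, (B.isPVM.hermitian z).eq,
        B.isPVM.idempotent]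
    rw [outcomeProb, this]
    exact (Complex.le_def.1 (dotProduct_star_self_nonneg (B.pvm z *ᵥ φ))).1
  have hsum : ∑ z, outcomeProb B.pvm φ z = 1 := by
    simp only [outcomeProb]
    rw [← Complex.re_sum, ← dotProduct_sum, ← Matrix.sum_mulVec, B.isPVM.complete, one_mulVec, hx,
      Complex.one_re]
  have hle : outcomeProb B.pvm φ y + outcomeProb B.pvm φ (B.transfer *ᵥ x) ≤ 1 := by
    rw [← hsum, ← Finset.sum_pair hne]
    exact Finset.sum_le_sum_of_subset_of_nonneg (Finset.subset_univ _) fun z _ _ => hnonneg z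
  rw [B.output] at hle
  exact hy (le_antisymm (by linarith) (hnonneg y))

theorem cssBox_state (V : Submodule F (Fin n → F)) (A : Matrix (Fin n) (Fin n ⊕ Fin n) F)
    (hsurj : Function.Surjective A.mulVec)
    (hker : ∀ x, A *ᵥ x = 0 ↔ x ∘ Sum.inl ∈ V ∧ ∀ c ∈ V, (x ∘ Sum.inr) ⬝ᵥ c = 0) :
    (cssBox p V A hsurj hker).state = codeState V := rfl

theorem cssBox_outcome_eq (V : Submodule F (Fin n → F)) (A : Matrix (Fin n) (Fin n ⊕ Fin n) F)
    (hsurj : Function.Surjective A.mulVec)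
    (hker : ∀ x, A *ᵥ x = 0 ↔ x ∘ Sum.inl ∈ V ∧ ∀ c ∈ V, (x ∘ Sum.inr) ⬝ᵥ c = 0)
    (x : Fin n ⊕ Fin n → F) {y : Fin n → F}
    (hy : outcomeProb (cssBox p V A hsurj hker).pvm
      (weyl p x *ᵥ (cssBox p V A hsurj hker).state) y ≠ 0) : y = A *ᵥ x :=
  SumBox.eq_of_outcomeProb_ne_zero p (cssBox p V A hsurj hker) x
    (by rw [cssBox_state, weyl_codeState_unit]) hy

end Box

/-! ### Cauchy–Vandermonde matrices, Reed–Solomon duality and the kernel of the transfer matrix. -/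

section CauchyVandermonde

open Polynomial

variable {F : Type u} [Field F] {n L : ℕ}

/-- The vector with the first `L` entries `c` and the other entries `ν`. -/
def joinVec (c : Fin L → F) (ν : Fin (n - L) → F) (j : Fin n) : F :=
  if h : (j : ℕ) < L then c ⟨j, h⟩ else ν ⟨(j : ℕ) - L, by omega⟩

theorem sum_eq_sum_add_sum (h : L ≤ n) (g : Fin n → F) :
    ∑ j, g j = ∑ l : Fin L, g (Fin.castLE h l) +
      ∑ j : Fin (n - L), g ⟨L + j, by omega⟩ := by
  obtain ⟨m, rfl⟩ := Nat.exists_eq_add_of_le h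
  rw [Fin.sum_univ_add]
  refine congrArg₂ (· + ·) rfl ?_
  exact Fintype.sum_equiv (finCongr (by omega)) _ _ fun j => rfl

theorem qcsaMatrix_mulVec_joinVec (h : L ≤ n) (α β : Fin n → F) (f : Fin L → F)
    (c : Fin L → F) (ν : Fin (n - L) → F) (i : Fin n) :
    (qcsaMatrix α β f *ᵥ joinVec c ν) i =
      β i * (∑ l, 1 / (f l - α i) * c l + ∑ j : Fin (n - L), α i ^ (j : ℕ) * ν j) := by
  rw [mulVec, dotProduct, sum_eq_sum_add_sum h, mul_add, Finset.mul_sum, Finset.mul_sum]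
  congr 1
  · refine Finset.sum_congr rfl fun l _ => ?_
    simp [qcsaMatrix, joinVec, div_eq_mul_inv, mul_assoc]
  · refine Finset.sum_congr rfl fun j _ => ?_
    simp [qcsaMatrix, joinVec, mul_assoc]

omit [Field F] in
theorem exists_eq_joinVec (h : L ≤ n) (w : Fin n → F) :
    ∃ (c : Fin L → F) (ν : Fin (n - L) → F), w = joinVec c ν := by
  refine ⟨fun l => w (Fin.castLE h l), fun j => w ⟨L + j, by omega⟩, funext fun j => ?_⟩
  rw [joinVec]
  split_ifs with hj
  · rfl
  · congr 1
    ext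
    simp
    omega

variable {α β : Fin n → F} {f : Fin L → F}

theorem sub_ne_zero_of_injective (hinj : Function.Injective (Sum.elim α f)) (l : Fin L)
    (i : Fin n) : f l - α i ≠ 0 :=
  sub_ne_zero.2 fun h => Sum.inr_ne_inl (@hinj (Sum.inr l) (Sum.inl i) h)

/-- A vector in the kernel of a Cauchy–Vandermonde matrix vanishes. -/
theorem eq_zero_of_qcsaMatrix_mulVec_eq_zero (h : L ≤ n)
    (hinj : Function.Injective (Sum.elim α f)) (hβ : ∀ i, β i ≠ 0) {w : Fin n → F}
    (hw : qcsaMatrix α β f *ᵥ w = 0) : w = 0 := by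
  classical
  obtain ⟨c, ν, rfl⟩ := exists_eq_joinVec h w
  have hα : Function.Injective α := fun i j hij => Sum.inl_injective (hinj hij)
  have hf : Function.Injective f := fun i j hij => Sum.inr_injective (hinj hij)
  set g : F[X] := ∑ j : Fin (n - L), C (ν j) * X ^ (j : ℕ) with hg
  -- This is `∑ c_l / (f_l - x) + g(x)` with denominators cleared by `∏ (x - f_l)`; the order of
  -- subtraction in `f_l - x` causes the minus sign. It has degree below `n` and `n` zeros.
  set P : F[X] := g * Lagrange.nodal Finset.univ f -
    ∑ l, C (c l) * Lagrange.nodal (Finset.univ.erase l) f with hP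
  have hPα : ∀ i, P.eval (α i) = 0 := fun i => by
    have hi := congrFun hw i
    rw [qcsaMatrix_mulVec_joinVec h, Pi.zero_apply] at hi
    have hi' := (mul_eq_zero.1 hi).resolve_left (hβ i)
    have hterm : ∀ l, c l * (Lagrange.nodal (Finset.univ.erase l) f).eval (α i) =
        -(1 / (f l - α i) * c l * (Lagrange.nodal Finset.univ f).eval (α i)) := fun l => by
      have hne := sub_ne_zero_of_injective hinj l i
      rw [Lagrange.nodal_eq_mul_nodal_erase (Finset.mem_univ l), eval_mul]
      simp only [eval_sub, eval_X, eval_C]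
      field_simp
      ring
    rw [hP, eval_sub, eval_mul, hg, eval_finsetSum, eval_finsetSum]
    simp only [eval_mul, eval_C, eval_pow, eval_X, hterm]
    rw [Finset.sum_neg_distrib, ← Finset.sum_mul, sub_neg_eq_add, ← add_mul]
    rw [Finset.sum_congr rfl fun j _ => mul_comm (ν j) _, add_comm, hi', zero_mul]
  have hgdeg : g.degree < (n - L : ℕ) := by
    rw [← mem_degreeLT, hg]
    refine Submodule.sum_mem _ fun j _ => mem_degreeLT.2 ?_
    exact (degree_C_mul_X_pow_le _ _).trans_lt (WithBot.coe_lt_coe.2 j.2)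
  have hPdeg : P.degree < n := by
    refine (degree_sub_le _ _).trans_lt (max_lt ?_ ?_)
    · rw [degree_mul, Lagrange.degree_nodal, Finset.card_univ, Fintype.card_fin]
      calc g.degree + (L : WithBot ℕ) < ((n - L : ℕ) : WithBot ℕ) + (L : WithBot ℕ) :=
            WithBot.add_lt_add_right (WithBot.natCast_ne_bot L) hgdeg
        _ = n := by rw [← Nat.cast_add, Nat.sub_add_cancel h]
    · rw [← mem_degreeLT]
      refine Submodule.sum_mem _ fun l _ => mem_degreeLT.2 ?_
      rw [← smul_eq_C_mul]
      refine (degree_smul_le _ _).trans_lt ?_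
      rw [Lagrange.degree_nodal, Finset.card_erase_of_mem (Finset.mem_univ l), Finset.card_univ,
        Fintype.card_fin]
      exact Nat.cast_lt.2 (by have := l.2; omega)
  have hP0 : P = 0 := by
    refine eq_zero_of_degree_lt_of_eval_index_eq_zero (s := Finset.univ) (v := α) hα.injOn ?_
      fun i _ => hPα i
    rwa [Finset.card_univ, Fintype.card_fin]
  -- At `f l` only the `l`-th Cauchy term survives.
  have hc : ∀ l, c l = 0 := fun l => by
    have hl : P.eval (f l) = 0 := by rw [hP0, eval_zero]
    rw [hP, eval_sub, eval_mul, Lagrange.eval_nodal_at_node (Finset.mem_univ l), mul_zero,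
      zero_sub, neg_eq_zero, eval_finsetSum, Finset.sum_eq_single l] at hl
    · rw [eval_mul, eval_C] at hl
      refine (mul_eq_zero.1 hl).resolve_right (Lagrange.eval_nodal_not_at_node fun k hk => ?_)
      exact fun hkl => Finset.ne_of_mem_erase hk (hf hkl).symm
    · intro k _ hk
      rw [eval_mul, Lagrange.eval_nodal_at_node (Finset.mem_erase.2 ⟨hk.symm, Finset.mem_univ l⟩),
        mul_zero]
    · simp
  have hg0 : g = 0 := by
    rw [hP] at hP0
    simpa [hc, Lagrange.nodal_ne_zero] using hP0
  have hν : ∀ j, ν j = 0 := fun j => by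
    have hj : g.coeff j = 0 := by rw [hg0, coeff_zero]
    simpa [hg, finsetSum_coeff, coeff_C_mul, coeff_X_pow, Fin.val_inj] using hj
  ext j
  simp [joinVec, hc, hν]

theorem det_qcsaMatrix_ne_zero (h : L ≤ n) (hinj : Function.Injective (Sum.elim α f))
    (hβ : ∀ i, β i ≠ 0) : (qcsaMatrix α β f).det ≠ 0 := fun h0 => by
  obtain ⟨w, hw, hw0⟩ := exists_mulVec_eq_zero_iff.2 h0
  exact hw (eq_zero_of_qcsaMatrix_mulVec_eq_zero h hinj hβ hw0)

theorem exists_qcsaMatrix_mulVec_eq (h : L ≤ n) (hinj : Function.Injective (Sum.elim α f))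
    (hβ : ∀ i, β i ≠ 0) (a : Fin n → F) : ∃ w, qcsaMatrix α β f *ᵥ w = a :=
  ⟨(qcsaMatrix α β f)⁻¹ *ᵥ a, by
    rw [mulVec_mulVec, mul_nonsing_inv _ (det_qcsaMatrix_ne_zero h hinj hβ).isUnit, one_mulVec]⟩

/-- The generalized Reed–Solomon code of dimension `k` with the points `α` and the
multipliers `β`. -/
def reedSolomon (α β : Fin n → F) (k : ℕ) : Submodule F (Fin n → F) :=
  (degreeLT F k).map (LinearMap.pi fun i => β i • leval (α i))

theorem mem_reedSolomon {k : ℕ} {a : Fin n → F} :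
    a ∈ reedSolomon α β k ↔ ∃ g : F[X], g.degree < k ∧ ∀ i, a i = β i * g.eval (α i) := by
  simp only [reedSolomon, Submodule.mem_map, mem_degreeLT, funext_iff, LinearMap.pi_apply,
    LinearMap.smul_apply, leval_apply, smul_eq_mul, eq_comm]

/-- The columns `L, …, L + k - 1` span this code, and coordinates with respect to the columns are
unique. -/
theorem qcsaMatrix_mulVec_mem_reedSolomon_iff (h : L ≤ n)
    (hinj : Function.Injective (Sum.elim α f)) (hβ : ∀ i, β i ≠ 0) {k : ℕ} (hk : k ≤ n - L)
    (w : Fin n → F) :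
    qcsaMatrix α β f *ᵥ w ∈ reedSolomon α β k ↔
      ∀ j : Fin n, ((j : ℕ) < L ∨ L + k ≤ j) → w j = 0 := by
  have heval : ∀ (g : F[X]), g.degree < k → ∀ i,
      (qcsaMatrix α β f *ᵥ joinVec 0 fun j => g.coeff j) i = β i * g.eval (α i) := fun g hg i => by
    rw [qcsaMatrix_mulVec_joinVec h]
    have hdeg : g.degree < (n - L : ℕ) := hg.trans_le (by exact_mod_cast hk)
    rw [eval_eq_sum_degreeLTEquiv (mem_degreeLT.2 hdeg)]
    simp [degreeLTEquiv, mul_comm]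
  rw [mem_reedSolomon]
  constructor
  · rintro ⟨g, hg, hgw⟩ j hj
    have hz : qcsaMatrix α β f *ᵥ (w - joinVec (0 : Fin L → F) fun j => g.coeff j) = 0 := by
      ext i
      rw [mulVec_sub, Pi.sub_apply, hgw, heval g hg, sub_self, Pi.zero_apply]
    rw [sub_eq_zero.1 (eq_zero_of_qcsaMatrix_mulVec_eq_zero h hinj hβ hz), joinVec]
    split_ifs with hjL
    · rfl
    · exact coeff_eq_zero_of_degree_lt (hg.trans_le (Nat.cast_le.2 (show k ≤ (j : ℕ) - L by omega)))
  · intro hw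
    obtain ⟨c, ν, rfl⟩ := exists_eq_joinVec h w
    refine ⟨∑ j : Fin (n - L), C (ν j) * X ^ (j : ℕ), ?_, fun i => ?_⟩
    · rw [← mem_degreeLT]
      refine Submodule.sum_mem _ fun j _ => mem_degreeLT.2 ?_
      by_cases hj : (j : ℕ) < k
      · exact (degree_C_mul_X_pow_le _ _).trans_lt (WithBot.coe_lt_coe.2 hj)
      · have := hw ⟨L + j, by omega⟩ (Or.inr (by simp; omega))
        have hνj : ν j = 0 := by simpa [joinVec] using this
        simp [hνj]
    · rw [qcsaMatrix_mulVec_joinVec h, eval_finsetSum]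
      have hc : ∀ l, c l = 0 := fun l => by
        simpa [joinVec] using hw (Fin.castLE h l) (Or.inl l.2)
      simp [hc, mul_comm (α i ^ _)]

theorem dualMultiplier_ne_zero {u : Fin n → F} (hα : Function.Injective α) (hu : ∀ i, u i ≠ 0)
    (i : Fin n) : dualMultiplier α u i ≠ 0 := by
  refine mul_ne_zero (inv_ne_zero (hu i)) (inv_ne_zero (Finset.prod_ne_zero_iff.2 fun j hj => ?_))
  exact sub_ne_zero.2 fun hij => Finset.ne_of_mem_erase hj (hα hij).symm

/-- The multipliers cancel up to the Lagrange weights, and the weighted sum of the values of a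
polynomial of degree below `n` is its coefficient at `n - 1`. -/
theorem dotProduct_dualMultiplier {u : Fin n → F} (hα : Function.Injective α)
    (hu : ∀ i, u i ≠ 0) {g h : F[X]} (hdeg : (h * g).degree < n) {a b : Fin n → F}
    (ha : ∀ i, a i = u i * g.eval (α i))
    (hb : ∀ i, b i = dualMultiplier α u i * h.eval (α i)) :
    b ⬝ᵥ a = (h * g).coeff (n - 1) := by
  have hc := Lagrange.coeff_eq_sum (s := Finset.univ) hα.injOn (P := h * g)
    (by rwa [Finset.card_univ, Fintype.card_fin])
  rw [Finset.card_univ, Fintype.card_fin] at hc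
  rw [hc, dotProduct]
  refine Finset.sum_congr rfl fun i _ => ?_
  have := hu i
  rw [ha, hb, dualMultiplier, eval_mul, div_eq_mul_inv]
  field_simp

/-- The dual of a generalized Reed–Solomon code is the generalized Reed–Solomon code with the
dual multipliers. -/
theorem mem_reedSolomon_dualMultiplier_iff {u : Fin n → F} (hα : Function.Injective α)
    (hu : ∀ i, u i ≠ 0) {k k' : ℕ} (hk : k + k' = n) (b : Fin n → F) :
    b ∈ reedSolomon α (dualMultiplier α u) k' ↔ ∀ a ∈ reedSolomon α u k, b ⬝ᵥ a = 0 := by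
  constructor
  · intro hb a ha
    obtain ⟨h, hh, hb⟩ := mem_reedSolomon.1 hb
    obtain ⟨g, hg, ha⟩ := mem_reedSolomon.1 ha
    by_cases h0 : h * g = 0
    · have hlt : (h * g).degree < n := by
        rw [h0, degree_zero]
        exact WithBot.bot_lt_coe n
      rw [dotProduct_dualMultiplier hα hu hlt ha hb, h0, coeff_zero]
    · obtain ⟨hh0, hg0⟩ := mul_ne_zero_iff.1 h0
      rw [← natDegree_lt_iff_degree_lt hh0] at hh
      rw [← natDegree_lt_iff_degree_lt hg0] at hg
      have hn := natDegree_mul hh0 hg0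
      rw [dotProduct_dualMultiplier hα hu
        ((natDegree_lt_iff_degree_lt h0).1 (by omega)) ha hb]
      exact coeff_eq_zero_of_natDegree_lt (by omega)
  · intro hb
    have hv := dualMultiplier_ne_zero hα hu
    set h : F[X] := Lagrange.interpolate Finset.univ α fun i => b i / dualMultiplier α u i
    have hbi : ∀ i, b i = dualMultiplier α u i * h.eval (α i) := fun i => by
      rw [Lagrange.eval_interpolate_at_node _ hα.injOn (Finset.mem_univ i),
        mul_div_cancel₀ _ (hv i)]
    have hdeg : h.degree < n := by
      have := Lagrange.degree_interpolate_lt (s := Finset.univ)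
        (fun i => b i / dualMultiplier α u i) hα.injOn
      rwa [Finset.card_univ, Fintype.card_fin] at this
    refine mem_reedSolomon.2 ⟨h, ?_, hbi⟩
    by_cases h0 : h = 0
    · rw [h0, degree_zero]
      exact WithBot.bot_lt_coe k'
    rw [← natDegree_lt_iff_degree_lt h0] at hdeg ⊢
    by_contra! hle
    -- If `h` had degree at least `k'`, this monomial would have degree below `k`, and pairing with
    -- it would extract the leading coefficient of `h`.
    have hX : (X ^ (n - 1 - h.natDegree) : F[X]) ≠ 0 := pow_ne_zero _ X_ne_zero
    have hdot := hb (fun i => u i * (X ^ (n - 1 - h.natDegree) : F[X]).eval (α i))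
      (mem_reedSolomon.2 ⟨_, by rw [← natDegree_lt_iff_degree_lt hX, natDegree_X_pow]; omega,
        fun i => rfl⟩)
    rw [dotProduct_dualMultiplier hα hu
      ((natDegree_lt_iff_degree_lt (mul_ne_zero h0 hX)).1
        (by rw [natDegree_mul h0 hX, natDegree_X_pow]; omega)) (fun i => rfl) hbi,
      coeff_mul_X_pow', if_pos (by omega), show n - 1 - (n - 1 - h.natDegree) = h.natDegree by omega,
      coeff_natDegree, leadingCoeff_eq_zero] at hdot
    exact h0 hdot

theorem selectedColumn_injective (h : 2 * L ≤ n) : Function.Injective (selectedColumn n L) := by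
  intro r s hrs
  unfold selectedColumn at hrs
  ext
  split_ifs at hrs <;> simp [Fin.ext_iff] at hrs <;> omega

/-- The transfer matrix inverts the Cauchy–Vandermonde matrices and selects. -/
theorem qcsaTransfer_mulVec (h : L ≤ n) {u v : Fin n → F}
    (hinj : Function.Injective (Sum.elim α f)) (hu : ∀ i, u i ≠ 0) (hv : ∀ i, v i ≠ 0)
    (w₁ w₂ : Fin n → F) (r : Fin n) :
    (qcsaTransfer α u v f *ᵥ
      Sum.elim (qcsaMatrix α u f *ᵥ w₁) (qcsaMatrix α v f *ᵥ w₂)) r =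
        Sum.elim w₁ w₂ (selectedColumn n L r) := by
  have hG : (fromBlocks (qcsaMatrix α u f) 0 0 (qcsaMatrix α v f)) *ᵥ Sum.elim w₁ w₂ =
      Sum.elim (qcsaMatrix α u f *ᵥ w₁) (qcsaMatrix α v f *ᵥ w₂) := by
    rw [fromBlocks_mulVec]
    simp
  have hdet : IsUnit (fromBlocks (qcsaMatrix α u f) 0 0 (qcsaMatrix α v f)).det := by
    rw [det_fromBlocks_zero₂₁]
    exact (mul_ne_zero (det_qcsaMatrix_ne_zero h hinj hu)
      (det_qcsaMatrix_ne_zero h hinj hv)).isUnit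
  have hT : qcsaTransfer α u v f = HMul.hMul (α := Matrix (Fin n) (Fin n ⊕ Fin n) F)
      (selectionMatrix n L) (fromBlocks (qcsaMatrix α u f) 0 0 (qcsaMatrix α v f))⁻¹ := rfl
  rw [← hG, mulVec_mulVec, hT, Matrix.mul_assoc, nonsing_inv_mul _ hdet, Matrix.mul_one]
  simp [selectionMatrix, mulVec, dotProduct]

theorem qcsaTransfer_surjective (h : 2 * L ≤ n) {u v : Fin n → F}
    (hinj : Function.Injective (Sum.elim α f)) (hu : ∀ i, u i ≠ 0) (hv : ∀ i, v i ≠ 0) :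
    Function.Surjective (qcsaTransfer α u v f).mulVec := fun y => by
  have hs := selectedColumn_injective h
  -- The discarded coordinates are set to zero.
  refine ⟨Sum.elim
    (qcsaMatrix α u f *ᵥ (Function.extend (selectedColumn n L) y 0 ∘ Sum.inl))
    (qcsaMatrix α v f *ᵥ (Function.extend (selectedColumn n L) y 0 ∘ Sum.inr)), funext fun r => ?_⟩
  rw [qcsaTransfer_mulVec (by omega) hinj hu hv, Sum.elim_comp_inl_inr, hs.extend_apply]

theorem forall_selectedColumn_iff (h : 2 * L ≤ n) (w₁ w₂ : Fin n → F) :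
    (∀ r, Sum.elim w₁ w₂ (selectedColumn n L r) = 0) ↔
      (∀ j : Fin n, ((j : ℕ) < L ∨ L + (n - n / 2) ≤ j) → w₁ j = 0) ∧
        ∀ j : Fin n, ((j : ℕ) < L ∨ L + n / 2 ≤ j) → w₂ j = 0 := by
  constructor
  · refine fun hr => ⟨fun j hj => ?_, fun j hj => ?_⟩
    · by_cases hjL : (j : ℕ) < L
      · have := hr j
        rwa [selectedColumn, dif_pos (by omega), if_pos hjL, Sum.elim_inl] at this
      · have := hr ⟨j - (n - n / 2), by omega⟩
        rw [selectedColumn, dif_pos (by simp; omega), if_neg (by simp; omega), Sum.elim_inl] at this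
        convert this using 2
        ext
        simp
        omega
    · by_cases hjL : (j : ℕ) < L
      · have := hr ⟨j + n / 2, by omega⟩
        rw [selectedColumn, dif_neg (by simp), if_pos (by simp; omega), Sum.elim_inr] at this
        convert this using 2
        ext
        simp
      · have := hr j
        rwa [selectedColumn, dif_neg (by omega), if_neg (by omega), Sum.elim_inr] at this
  · rintro ⟨h₁, h₂⟩ r
    unfold selectedColumn
    split_ifs with hr hrL hrL
    · exact h₁ _ (Or.inl hrL)
    · exact h₁ _ (Or.inr (by simp; omega))
    · exact h₂ _ (Or.inl (by simp; omega))
    · exact h₂ _ (Or.inr (by omega))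

/-- In Cauchy–Vandermonde coordinates the kernel is the span of the discarded columns: a
Reed–Solomon code of dimension `⌈n/2⌉` and, in the second block, its dual of dimension `⌊n/2⌋`. This
is the hypothesis of `cssBox`. -/
theorem qcsaTransfer_mulVec_eq_zero_iff (h : 2 * L ≤ n) {u : Fin n → F}
    (hinj : Function.Injective (Sum.elim α f)) (hu : ∀ i, u i ≠ 0) (x : Fin n ⊕ Fin n → F) :
    qcsaTransfer α u (dualMultiplier α u) f *ᵥ x = 0 ↔
      x ∘ Sum.inl ∈ reedSolomon α u (n - n / 2) ∧
        ∀ c ∈ reedSolomon α u (n - n / 2), (x ∘ Sum.inr) ⬝ᵥ c = 0 := by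
  have hα : Function.Injective α := fun i j hij => Sum.inl_injective (hinj hij)
  have hv := dualMultiplier_ne_zero hα hu
  have hL : L ≤ n := by omega
  obtain ⟨w₁, h₁⟩ := exists_qcsaMatrix_mulVec_eq hL hinj hu (x ∘ Sum.inl)
  obtain ⟨w₂, h₂⟩ := exists_qcsaMatrix_mulVec_eq hL hinj hv (x ∘ Sum.inr)
  rw [← mem_reedSolomon_dualMultiplier_iff hα hu (k' := n / 2) (by omega), ← h₁, ← h₂,
    qcsaMatrix_mulVec_mem_reedSolomon_iff hL hinj hu (by omega),
    qcsaMatrix_mulVec_mem_reedSolomon_iff hL hinj hv (by omega),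
    ← forall_selectedColumn_iff h, funext_iff]
  have hx : x = Sum.elim (qcsaMatrix α u f *ᵥ w₁) (qcsaMatrix α (dualMultiplier α u) f *ᵥ w₂) := by
    rw [h₁, h₂, Sum.elim_comp_inl_inr]
  refine forall_congr' fun r => ?_
  rw [hx, qcsaTransfer_mulVec hL hinj hu hv, Pi.zero_apply]

end CauchyVandermonde

/-! ### Cross-subspace alignment: storage, queries and answers. -/

section Retrieval

open Polynomial

variable {F : Type u} [Field F]

/-- A translation of the randomness does not change the law of a function of it. -/
theorem map_uniformOfFintype_eq_of_add {R β : Type*} [Fintype R] [Nonempty R] [AddGroup R]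
    {g h : R → β} (δ : R) (hgh : ∀ ρ, g ρ = h (ρ + δ)) :
    (PMF.uniformOfFintype R).map g = (PMF.uniformOfFintype R).map h := by
  classical
  ext b
  rw [PMF.map_apply, PMF.map_apply, ← (Equiv.addRight δ).tsum_eq fun ρ =>
    if b = h ρ then PMF.uniformOfFintype R ρ else 0]
  simp [hgh]

/-- At any at most `T` points a polynomial of degree less than `T` takes prescribed values. -/
theorem exists_sum_mul_pow_eq {ι : Type*} (C : Finset ι) (d c : ι → F)
    (hd : Set.InjOn d C) {T : ℕ} (hC : C.card ≤ T) :
    ∃ δ : Fin T → F, ∀ s ∈ C, ∑ t : Fin T, δ t * d s ^ (t : ℕ) = c s := by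
  classical
  refine ⟨fun t => (Lagrange.interpolate C d c).coeff t, fun s hs => ?_⟩
  have hdeg : (Lagrange.interpolate C d c).degree < T :=
    (Lagrange.degree_interpolate_lt c hd).trans_le (Nat.cast_le.2 hC)
  rw [← Lagrange.eval_interpolate_at_node c hd hs, eval_eq_sum_degreeLTEquiv (mem_degreeLT.2 hdeg)]
  simp [degreeLTEquiv]

section Polynomials

variable {n L : ℕ} {α : Fin n → F}

theorem mem_reedSolomon_one_iff {k : ℕ} {a : Fin n → F} :
    a ∈ reedSolomon α 1 k ↔ ∃ ν : Fin k → F, ∀ i, a i = ∑ j : Fin k, α i ^ (j : ℕ) * ν j := by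
  rw [mem_reedSolomon]
  constructor
  · rintro ⟨g, hg, h⟩
    refine ⟨fun j => g.coeff j, fun i => ?_⟩
    rw [h, eval_eq_sum_degreeLTEquiv (mem_degreeLT.2 hg)]
    simp [degreeLTEquiv, mul_comm (α i ^ _)]
  · rintro ⟨ν, h⟩
    refine ⟨∑ j : Fin k, C (ν j) * X ^ (j : ℕ), ?_, fun i => ?_⟩
    · rw [← mem_degreeLT]
      exact Submodule.sum_mem _ fun j _ => mem_degreeLT.2
        ((degree_C_mul_X_pow_le _ _).trans_lt (Nat.cast_lt.2 j.2))
    · rw [h, eval_finsetSum]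
      simp [mul_comm (α i ^ _)]

theorem sub_pow_mem_reedSolomon {k e : ℕ} (he : e < k) (z : F) :
    (fun i => (z - α i) ^ e) ∈ reedSolomon α 1 k := by
  refine mem_reedSolomon.2 ⟨(C z - X) ^ e, ?_, fun i => by simp⟩
  refine (degree_pow_le_of_le (a := 1) e ?_).trans_lt ?_
  · exact (degree_sub_le _ _).trans (max_le (degree_C_le.trans zero_le_one) degree_X_le)
  · rw [mul_one]
    exact Nat.cast_lt.2 he

theorem sum_smul_sub_pow_mem_reedSolomon {κ : Type*} (s : Finset κ) {k : ℕ} (e : κ → ℕ)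
    (he : ∀ j ∈ s, e j < k) (z : F) (c : κ → F) :
    (fun i => ∑ j ∈ s, c j * (z - α i) ^ e j) ∈ reedSolomon α 1 k := by
  have h := Submodule.sum_mem (reedSolomon α 1 k) (t := s)
    (f := fun j => c j • fun i => (z - α i) ^ e j)
    fun j hj => Submodule.smul_mem _ _ (sub_pow_mem_reedSolomon (he j hj) z)
  convert h using 1
  ext i
  simp

end Polynomials

/-- The terms `k = κ`, `k < κ` and `k > κ` give the simple pole, the higher poles and the polynomial
part. -/
theorem sum_inv_pow_mul_pow {K : ℕ} (κ : Fin K) {d : F} (hd : d ≠ 0) (w : Fin K → F) :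
    ∑ k : Fin K, (d ^ ((κ : ℕ) + 1))⁻¹ * (d ^ (k : ℕ) * w k) =
      1 / d * w κ + ∑ k ∈ Finset.univ.filter (· < κ), 1 / d ^ ((κ : ℕ) - (k : ℕ) + 1) * w k +
        ∑ k ∈ Finset.univ.filter (κ < ·), w k * d ^ ((k : ℕ) - (κ + 1)) := by
  rw [Finset.sum_filter, Finset.sum_filter, ← Fintype.sum_ite_eq κ fun k => 1 / d * w k,
    ← Finset.sum_add_distrib, ← Finset.sum_add_distrib]
  refine Finset.sum_congr rfl fun k _ => ?_
  rcases lt_trichotomy k κ with h | h | h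
  · rw [if_neg h.ne', if_pos h, if_neg h.not_gt, zero_add, add_zero]
    have : d ^ ((κ : ℕ) + 1) = d ^ ((κ : ℕ) - k + 1) * d ^ (k : ℕ) := by
      rw [← pow_add]
      congr 1
      have : (k : ℕ) < κ := h
      omega
    rw [this]
    field_simp
  · subst h
    rw [if_pos rfl, if_neg (lt_irrefl _), if_neg (lt_irrefl _), add_zero, add_zero, pow_succ]
    field_simp
  · rw [if_neg h.ne, if_neg h.not_gt, if_pos h, zero_add, zero_add]
    have : d ^ (k : ℕ) = d ^ ((k : ℕ) - (κ + 1)) * d ^ ((κ : ℕ) + 1) := by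
      rw [← pow_add]
      congr 1
      have : (κ : ℕ) < k := h
      omega
    rw [this]
    field_simp

variable {N n L K X T M : ℕ}

/-- The code symbols of block `(b, l)` are the values of a polynomial of degree less than `K + X`
in `f_l - a_s`, the coefficients of which are the message symbols followed by the noise symbols. -/
def csaCode (K X : ℕ) (a : Fin N → F) (f : Fin L → F) (j : Fin 2 × Fin L) :
    Matrix (Fin N) (Fin K ⊕ Fin X) F :=
  Matrix.of fun s c => (f j.2 - a s) ^ (finSumFinEquiv c : ℕ)

theorem det_csaCode_submatrix_ne_zero {a : Fin N → F} {f : Fin L → F}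
    (ha : Function.Injective a) (j : Fin 2 × Fin L) (e : Fin K ⊕ Fin X → Fin N)
    (he : Function.Injective e) : ((csaCode K X a f j).submatrix e id).det ≠ 0 := by
  have h : (csaCode K X a f j).submatrix e id =
      (vandermonde fun i => f j.2 - a (e (finSumFinEquiv.symm i))).submatrix
        finSumFinEquiv finSumFinEquiv := by
    ext i c
    simp [csaCode, vandermonde_apply]
  rw [h, det_submatrix_equiv_self, det_vandermonde_ne_zero_iff]
  intro i i' hii
  exact finSumFinEquiv.symm.injective (he (ha (sub_right_injective hii)))

/-- The query of round `κ`: the indicator of the desired message, masked by a multiple of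
`(f_l - α)^(κ + 1)`. -/
def csaQuery {M : ℕ} (f : Fin L → F) (κ : Fin K) (θ : Fin M)
    (ρ : Fin K → Fin M → Fin 2 × Fin L → Fin T → F) (α : F) (m : Fin M) (j : Fin 2 × Fin L) : F :=
  (if m = θ then 1 else 0) +
    (f j.2 - α) ^ ((κ : ℕ) + 1) * ∑ t : Fin T, ρ κ m j t * (f j.2 - α) ^ (t : ℕ)

/-- The answer of one instance `b` in round `κ`. -/
def csaAnswer {M : ℕ} (f : Fin L → F) (κ : Fin K) (α : F)
    (Q s : Fin M → Fin 2 × Fin L → F) (b : Fin 2) : F :=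
  ∑ m, ∑ l, ((f l - α) ^ ((κ : ℕ) + 1))⁻¹ * Q m (b, l) * s m (b, l)

/-- Apart from the polar part, the product has four polynomial pieces: the indicator times later
message symbols (`h₁`) or noise (`h₂`), and the mask times message symbols (`h₃`) or noise (`h₄`).
The largest possible exponent, `(T - 1) + (K + X - 1)`, occurs in `h₄` and is the origin of `I`. -/
theorem csaQuery_mul_storage_sub_mem {α : Fin n → F} {f : Fin L → F}
    (hinj : Function.Injective (Sum.elim α f)) {I : ℕ} (hI : X + T + K - 1 ≤ I) (κ : Fin K)
    (l : Fin L) (δ : F) (r : Fin T → F) (w : Fin K → F) (z : Fin X → F) :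
    (fun i => ((f l - α i) ^ ((κ : ℕ) + 1))⁻¹ *
        (δ + (f l - α i) ^ ((κ : ℕ) + 1) * ∑ t : Fin T, r t * (f l - α i) ^ (t : ℕ)) *
        (∑ k : Fin K, (f l - α i) ^ (k : ℕ) * w k + ∑ x : Fin X, (f l - α i) ^ (K + x) * z x) -
      δ * (1 / (f l - α i) * w κ + ∑ k ∈ Finset.univ.filter (· < κ),
        1 / (f l - α i) ^ ((κ : ℕ) - (k : ℕ) + 1) * w k)) ∈ reedSolomon α 1 I := by
  have hκ := κ.2
  have h₁ := Submodule.smul_mem _ δ (sum_smul_sub_pow_mem_reedSolomon (α := α)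
    (Finset.univ.filter (κ < ·)) (k := I) (fun k : Fin K => (k : ℕ) - (κ + 1))
    (fun k hk => by
      have h₁ : (κ : ℕ) < k := (Finset.mem_filter.1 hk).2
      have h₂ := k.2
      omega) (f l) w)
  have h₂ := Submodule.smul_mem _ δ (sum_smul_sub_pow_mem_reedSolomon (α := α)
    Finset.univ (k := I) (fun x : Fin X => K + (x : ℕ) - (κ + 1))
    (fun x _ => by have := x.2; omega) (f l) z)
  have h₃ := sum_smul_sub_pow_mem_reedSolomon (α := α)
    Finset.univ (k := I) (fun tk : Fin T × Fin K => (tk.1 : ℕ) + tk.2)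
    (fun tk _ => by have := tk.1.2; have := tk.2.2; omega) (f l) fun tk => r tk.1 * w tk.2
  have h₄ := sum_smul_sub_pow_mem_reedSolomon (α := α)
    Finset.univ (k := I) (fun tx : Fin T × Fin X => (tx.1 : ℕ) + (K + tx.2))
    (fun tx _ => by have := tx.1.2; have := tx.2.2; omega) (f l) fun tx => r tx.1 * z tx.2
  convert Submodule.add_mem _ (Submodule.add_mem _ h₁ h₂) (Submodule.add_mem _ h₃ h₄) using 1
  ext i
  have hd := sub_ne_zero_of_injective hinj l i
  have hw := sum_inv_pow_mul_pow κ hd w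
  have hz : ∑ x : Fin X, ((f l - α i) ^ ((κ : ℕ) + 1))⁻¹ * ((f l - α i) ^ (K + (x : ℕ)) * z x) =
      ∑ x : Fin X, z x * (f l - α i) ^ (K + (x : ℕ) - (κ + 1)) :=
    Finset.sum_congr rfl fun x _ => by
      have : (f l - α i) ^ (K + (x : ℕ)) =
          (f l - α i) ^ (K + (x : ℕ) - (κ + 1)) * (f l - α i) ^ ((κ : ℕ) + 1) := by
        rw [← pow_add]
        congr 1
        omega
      rw [this]
      field_simp
  rw [← Finset.mul_sum] at hw hz
  have hp := pow_ne_zero ((κ : ℕ) + 1) hd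
  simp only [Pi.add_apply, Pi.smul_apply, smul_eq_mul, ← Finset.univ_product_univ,
    Finset.sum_product]
  have h₃' : ∑ t : Fin T, ∑ k : Fin K, r t * w k * (f l - α i) ^ ((t : ℕ) + k) =
      (∑ t : Fin T, r t * (f l - α i) ^ (t : ℕ)) * ∑ k : Fin K, (f l - α i) ^ (k : ℕ) * w k := by
    rw [Finset.sum_mul_sum]
    exact Finset.sum_congr rfl fun t _ => Finset.sum_congr rfl fun k _ => by ring
  have h₄' : ∑ t : Fin T, ∑ x : Fin X, r t * z x * (f l - α i) ^ ((t : ℕ) + (K + x)) =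
      (∑ t : Fin T, r t * (f l - α i) ^ (t : ℕ)) *
        ∑ x : Fin X, (f l - α i) ^ (K + (x : ℕ)) * z x := by
    rw [Finset.sum_mul_sum]
    exact Finset.sum_congr rfl fun t _ => Finset.sum_congr rfl fun x _ => by ring
  rw [h₃', h₄', ← hz]
  have hp' := inv_mul_cancel₀ hp
  linear_combination δ * hw + (∑ t : Fin T, r t * (f l - α i) ^ (t : ℕ)) *
    (∑ k : Fin K, (f l - α i) ^ (k : ℕ) * w k +
      ∑ x : Fin X, (f l - α i) ^ (K + (x : ℕ)) * z x) * hp'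

theorem exists_csaAnswer_eq {α : Fin n → F} {f : Fin L → F}
    (hinj : Function.Injective (Sum.elim α f)) (hI : X + T + K - 1 ≤ n - L) (κ : Fin K)
    (θ : Fin M) (ρ : Fin K → Fin M → Fin 2 × Fin L → Fin T → F)
    (W : Fin M → Fin 2 × Fin L → Fin K → F) (Z : Fin M → Fin 2 × Fin L → Fin X → F) (b : Fin 2) :
    ∃ ν : Fin (n - L) → F, ∀ i,
      csaAnswer f κ (α i) (csaQuery f κ θ ρ (α i)) (fun m j =>
        ∑ k : Fin K, (f j.2 - α i) ^ (k : ℕ) * W m j k +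
          ∑ x : Fin X, (f j.2 - α i) ^ (K + (x : ℕ)) * Z m j x) b =
        ∑ l, 1 / (f l - α i) * W θ (b, l) κ + ∑ j : Fin (n - L), α i ^ (j : ℕ) * ν j +
          ∑ l, ∑ k ∈ Finset.univ.filter (· < κ),
            1 / (f l - α i) ^ ((κ : ℕ) - (k : ℕ) + 1) * W θ (b, l) k := by
  have hmem := Submodule.sum_mem (reedSolomon α 1 (n - L)) (t := (Finset.univ : Finset (Fin M)))
    fun m _ => Submodule.sum_mem _ (t := (Finset.univ : Finset (Fin L))) fun l _ =>
      csaQuery_mul_storage_sub_mem hinj hI κ l (if m = θ then 1 else 0) (ρ κ m (b, l))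
        (W m (b, l)) (Z m (b, l))
  obtain ⟨ν, hν⟩ := mem_reedSolomon_one_iff.1 hmem
  refine ⟨ν, fun i => ?_⟩
  rw [← hν i]
  simp only [Finset.sum_apply, Finset.sum_sub_distrib, csaAnswer, csaQuery]
  -- Polar parts of undesired messages vanish, so those messages contribute only interference.
  have hθ : ∑ m : Fin M, ∑ l : Fin L, (if m = θ then (1 : F) else 0) *
      (1 / (f l - α i) * W m (b, l) κ + ∑ k ∈ Finset.univ.filter (· < κ),
        1 / (f l - α i) ^ ((κ : ℕ) - (k : ℕ) + 1) * W m (b, l) k) =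
      ∑ l, 1 / (f l - α i) * W θ (b, l) κ + ∑ l, ∑ k ∈ Finset.univ.filter (· < κ),
            1 / (f l - α i) ^ ((κ : ℕ) - (k : ℕ) + 1) * W θ (b, l) k := by
    rw [Finset.sum_eq_single θ (fun m _ hm => by simp [hm]) (by simp)]
    simp only [if_true, one_mul, Finset.sum_add_distrib]
  rw [hθ]
  ring

end Retrieval

/-- The outcomes `y` of all rounds arise from desired symbols `w` and some interference. -/
def IsOutcome {F : Type u} [Field F] {n L K : ℕ} (α u v : Fin n → F) (f : Fin L → F)
    (w : Fin 2 × Fin L → Fin K → F) (y : Fin K → Fin n → F) : Prop :=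
  ∃ (A : Fin K → Fin 2 → Fin n → F) (ν : Fin K → Fin 2 → Fin (n - L) → F),
    (∀ κ b i, A κ b i = ∑ l, 1 / (f l - α i) * w (b, l) κ
      + ∑ j : Fin (n - L), α i ^ (j : ℕ) * ν κ b j
      + ∑ l, ∑ k ∈ Finset.univ.filter (· < κ),
        1 / (f l - α i) ^ ((κ : ℕ) - (k : ℕ) + 1) * w (b, l) k) ∧
    ∀ κ, y κ = qcsaTransfer α u v f *ᵥ
      Sum.elim (fun i => u i * A κ 0 i) (fun i => v i * A κ 1 i)

/-- If the inputs have the Cauchy–Vandermonde form, then the outcomes of all rounds determine the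
desired symbols. -/
theorem IsOutcome.eq {F : Type u} [Field F] {n L K : ℕ} (h : 2 * L ≤ n)
    {α u v : Fin n → F} {f : Fin L → F} (hinj : Function.Injective (Sum.elim α f))
    (hu : ∀ i, u i ≠ 0) (hv : ∀ i, v i ≠ 0) {w w' : Fin 2 × Fin L → Fin K → F}
    {y : Fin K → Fin n → F} (hy : IsOutcome α u v f w y) (hy' : IsOutcome α u v f w' y) :
    w = w' := by
  obtain ⟨A, ν, hA, hyA⟩ := hy
  obtain ⟨A', ν', hA', hyA'⟩ := hy'
  have hL : L ≤ n := by omega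
  suffices ∀ (κ : Fin K) j, w j κ = w' j κ from funext fun j => funext fun κ => this κ j
  intro κ
  induction κ using WellFoundedLT.induction with
  | _ κ ih =>
  -- Coordinates of the difference of two explanations of the same outcome; the higher poles have
  -- cancelled by induction on the round.
  let c : Fin 2 → Fin n → F := fun b =>
    joinVec (fun l => w (b, l) κ - w' (b, l) κ) (fun j => ν κ b j - ν' κ b j)
  have hdiff : ∀ (β : Fin n → F) b i, β i * A κ b i - β i * A' κ b i =
      (qcsaMatrix α β f *ᵥ c b) i := fun β b i => by
    have hlow : ∑ l, ∑ k ∈ Finset.univ.filter (· < κ),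
          1 / (f l - α i) ^ ((κ : ℕ) - (k : ℕ) + 1) * w (b, l) k =
        ∑ l, ∑ k ∈ Finset.univ.filter (· < κ),
          1 / (f l - α i) ^ ((κ : ℕ) - (k : ℕ) + 1) * w' (b, l) k :=
      Finset.sum_congr rfl fun l _ => Finset.sum_congr rfl fun k hk => by
        rw [ih k (Finset.mem_filter.1 hk).2]
    rw [qcsaMatrix_mulVec_joinVec hL, hA, hA', hlow]
    simp only [mul_sub, Finset.sum_sub_distrib]
    ring
  have hsub : Sum.elim (fun i => u i * A κ 0 i) (fun i => v i * A κ 1 i) -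
      Sum.elim (fun i => u i * A' κ 0 i) (fun i => v i * A' κ 1 i) =
      Sum.elim (qcsaMatrix α u f *ᵥ c 0) (qcsaMatrix α v f *ᵥ c 1) := by
    ext (i | i)
    · exact hdiff u 0 i
    · exact hdiff v 1 i
  have hz : ∀ r, Sum.elim (c 0) (c 1) (selectedColumn n L r) = 0 := fun r => by
    rw [← qcsaTransfer_mulVec hL hinj hu hv, ← hsub, mulVec_sub, ← hyA κ, ← hyA' κ, sub_self,
      Pi.zero_apply]
  obtain ⟨h₀, h₁⟩ := (forall_selectedColumn_iff h _ _).1 hz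
  have hc : ∀ b (l : Fin L), c b (Fin.castLE hL l) = w (b, l) κ - w' (b, l) κ := fun b l => by
    simp [c, joinVec]
  rintro ⟨b, l⟩
  rw [← sub_eq_zero, ← hc]
  fin_cases b
  · exact h₀ _ (Or.inl l.2)
  · exact h₁ _ (Or.inl l.2)

/-! ### The scheme and its properties. -/

section Construction

variable (p : ℕ) [Fact p.Prime] {F : Type u} [Field F] [Fintype F] [DecidableEq F]
  [Algebra (ZMod p) F] {N n L : ℕ}

/-- The sum box with the transfer matrix `M_QCSA`. -/
def qcsaBox (h : 2 * L ≤ n) {α u : Fin n → F} {f : Fin L → F}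
    (hinj : Function.Injective (Sum.elim α f)) (hu : ∀ i, u i ≠ 0) : SumBox p F n :=
  cssBox p (reedSolomon α u (n - n / 2)) (qcsaTransfer α u (dualMultiplier α u) f)
    (qcsaTransfer_surjective h hinj hu
      (dualMultiplier_ne_zero (fun _ _ hij => Sum.inl_injective (hinj hij)) hu))
    (qcsaTransfer_mulVec_eq_zero_iff h hinj hu)

theorem qcsaBox_outcome_eq (h : 2 * L ≤ n) {α u : Fin n → F} {f : Fin L → F}
    (hinj : Function.Injective (Sum.elim α f)) (hu : ∀ i, u i ≠ 0) (x : Fin n ⊕ Fin n → F)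
    {y : Fin n → F} (hy : outcomeProb (qcsaBox p h hinj hu).pvm
      (weyl p x *ᵥ (qcsaBox p h hinj hu).state) y ≠ 0) :
    y = qcsaTransfer α u (dualMultiplier α u) f *ᵥ x :=
  cssBox_outcome_eq p _ _
    (qcsaTransfer_surjective h hinj hu
      (dualMultiplier_ne_zero (fun _ _ hij => Sum.inl_injective (hinj hij)) hu))
    (qcsaTransfer_mulVec_eq_zero_iff h hinj hu) x hy

/-- Cross-subspace alignment over the QCSA box, with the points `a` for the servers. -/
def csaScheme (M K X T : ℕ) (h : 2 * L ≤ n) (server : Fin n ↪ Fin N) {a : Fin N → F}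
    {f : Fin L → F} (hinj : Function.Injective (Sum.elim (a ∘ server) f)) :
    Scheme p F N M K X n K (Fin 2 × Fin L) where
  code := csaCode K X a f
  server := server
  Rand := Fin K → Fin M → Fin 2 × Fin L → Fin T → F
  Query := Fin M → Fin 2 × Fin L → F
  query κ θ ρ i := csaQuery f κ θ ρ (a (server i))
  answer κ i Q s := (csaAnswer f κ (a (server i)) Q s 0,
    dualMultiplier (a ∘ server) 1 i * csaAnswer f κ (a (server i)) Q s 1)
  box := qcsaBox p h (u := 1) hinj fun _ => one_ne_zero
  -- Any message consistent with the outcomes will do: `IsOutcome.eq` shows that there is at most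
  -- one.
  decode _ _ y := Classical.epsilon fun w =>
    IsOutcome (a ∘ server) 1 (dualMultiplier (a ∘ server) 1) f w y

variable {M K X T : ℕ} (h : 2 * L ≤ n) (server : Fin n ↪ Fin N) {a : Fin N → F} {f : Fin L → F}
  (hinj : Function.Injective (Sum.elim (a ∘ server) f))

theorem csaScheme_storage (W : Fin M → Fin 2 × Fin L → Fin K → F)
    (Z : Fin M → Fin 2 × Fin L → Fin X → F) (s : Fin N) :
    (csaScheme p M K X T h server hinj).storage W Z s = fun m j =>
      ∑ k : Fin K, (f j.2 - a s) ^ (k : ℕ) * W m j k +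
        ∑ x : Fin X, (f j.2 - a s) ^ (K + (x : ℕ)) * Z m j x := by
  ext m j
  simp [csaScheme, Scheme.storage, csaCode]

theorem csaScheme_isMDSCoded (hN : K + X ≤ N) (ha : Function.Injective a) :
    (csaScheme p M K X T h server hinj).IsMDSCoded :=
  ⟨hN, fun j e he => det_csaCode_submatrix_ne_zero ha j e he⟩

/-- On at most `X` servers a shift of the noise compensates a change of the messages. The shift
interpolates a quotient by `(f_l - a_s) ^ K`, so the `f_l` must avoid the points of all servers,
including those not queried. -/
theorem csaScheme_isSecure (haf : Function.Injective (Sum.elim a f)) :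
    (csaScheme p M K X T h server hinj).IsSecure := by
  intro C hC W W'
  have ha : Function.Injective a := fun i j hij => Sum.inl_injective (haf hij)
  have hex : ∀ m (j : Fin 2 × Fin L), ∃ δ : Fin X → F, ∀ s ∈ C,
      ∑ x : Fin X, δ x * (f j.2 - a s) ^ (x : ℕ) =
        ((f j.2 - a s) ^ K)⁻¹ * ∑ k : Fin K, (f j.2 - a s) ^ (k : ℕ) * (W m j k - W' m j k) :=
    fun m j => exists_sum_mul_pow_eq C (fun s => f j.2 - a s) _
      (fun s _ s' _ hs => ha (sub_right_injective hs)) hC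
  choose δ hδ using hex
  refine map_uniformOfFintype_eq_of_add δ fun Z => ?_
  ext ⟨s, hs⟩ m j
  have hd := hδ m j s hs
  have hne := pow_ne_zero K (sub_ne_zero_of_injective haf j.2 s)
  have hpow : ∑ x : Fin X, (f j.2 - a s) ^ (K + (x : ℕ)) * δ m j x =
      ∑ k : Fin K, (f j.2 - a s) ^ (k : ℕ) * (W m j k - W' m j k) := by
    rw [← mul_inv_cancel_left₀ hne (∑ k : Fin K, (f j.2 - a s) ^ (k : ℕ) * (W m j k - W' m j k)),
      ← hd, Finset.mul_sum]
    exact Finset.sum_congr rfl fun x _ => by ring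
  simp only [mul_sub, Finset.sum_sub_distrib] at hpow
  simp only [csaScheme_storage, Pi.add_apply, mul_add, Finset.sum_add_distrib]
  linear_combination -hpow

/-- The same argument with the mask: its shift interpolates the difference of two indicators divided
by `(f_l - a_s) ^ (κ + 1)`, independently in each round. -/
theorem csaScheme_isPrivate (haf : Function.Injective (Sum.elim a f)) :
    (csaScheme p M K X T h server hinj).IsPrivate T := by
  intro C hC θ θ'
  have ha : Function.Injective a := fun i j hij => Sum.inl_injective (haf hij)
  have hex : ∀ (κ : Fin K) (m : Fin M) (j : Fin 2 × Fin L), ∃ δ : Fin T → F, ∀ s ∈ C,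
      ∑ t : Fin T, δ t * (f j.2 - a s) ^ (t : ℕ) = ((f j.2 - a s) ^ ((κ : ℕ) + 1))⁻¹ *
        ((if m = θ then 1 else 0) - if m = θ' then 1 else 0) :=
    fun κ m j => exists_sum_mul_pow_eq C (fun s => f j.2 - a s) _
      (fun s _ s' _ hs => ha (sub_right_injective hs)) hC
  choose δ hδ using hex
  refine map_uniformOfFintype_eq_of_add (R := Fin K → Fin M → Fin 2 × Fin L → Fin T → F) δ
    fun ρ => ?_
  ext κ ⟨i, hi⟩
  refine funext fun m => funext fun j => ?_
  have hd := hδ κ m j (server i) hi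
  have hne := pow_ne_zero ((κ : ℕ) + 1) (sub_ne_zero_of_injective haf j.2 (server i))
  rw [eq_inv_mul_iff_mul_eq₀ hne] at hd
  change csaQuery f κ θ ρ (a (server i)) m j = csaQuery f κ θ' (ρ + δ) (a (server i)) m j
  simp only [csaQuery, Pi.add_apply, add_mul, Finset.sum_add_distrib, mul_add]
  linear_combination -hd

theorem exists_csaScheme_input_eq (hI : X + T + K - 1 ≤ n - L)
    (W : Fin M → Fin 2 × Fin L → Fin K → F) (Z : Fin M → Fin 2 × Fin L → Fin X → F) (θ : Fin M)
    (ρ : (csaScheme p M K X T h server hinj).Rand) (κ : Fin K) :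
    ∃ (A : Fin 2 → Fin n → F) (ν : Fin 2 → Fin (n - L) → F),
      (∀ b i, A b i =
        ∑ l, 1 / (f l - a (server i)) * W θ (b, l) κ
          + ∑ j : Fin (n - L), a (server i) ^ (j : ℕ) * ν b j
          + ∑ l, ∑ k ∈ Finset.univ.filter (· < κ),
              1 / (f l - a (server i)) ^ ((κ : ℕ) - (k : ℕ) + 1) * W θ (b, l) k) ∧
      (csaScheme p M K X T h server hinj).input W Z θ ρ κ =
        Sum.elim (fun i => 1 * A 0 i) (fun i => dualMultiplier (a ∘ server) 1 i * A 1 i) := by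
  choose ν hν using exists_csaAnswer_eq hinj hI κ θ ρ W Z
  refine ⟨fun b i => csaAnswer f κ (a (server i)) (csaQuery f κ θ ρ (a (server i)))
    ((csaScheme p M K X T h server hinj).storage W Z (server i)) b, ν, fun b i => ?_, ?_⟩
  · exact (congrArg (fun s => csaAnswer f κ (a (server i)) (csaQuery f κ θ ρ (a (server i))) s b)
      (csaScheme_storage p h server hinj W Z (server i))).trans (hν b i)
  · simp only [one_mul]
    rfl

theorem csaScheme_isQCSA (hI : X + T + K - 1 ≤ n - L) :
    (csaScheme p M K X T h server hinj).IsQCSA :=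
  ⟨h, a ∘ server, 1, dualMultiplier (a ∘ server) 1, f, hinj, fun _ => one_ne_zero, rfl, rfl,
    exists_csaScheme_input_eq p h server hinj hI⟩

theorem csaScheme_isCorrect (hI : X + T + K - 1 ≤ n - L) :
    (csaScheme p M K X T h server hinj).IsCorrect := by
  intro W Z θ ρ y hy
  have hα : Function.Injective (a ∘ server) := fun i j hij => Sum.inl_injective (hinj hij)
  have hu : ∀ i : Fin n, (1 : Fin n → F) i ≠ 0 := fun _ => one_ne_zero
  choose A ν hA hinput using exists_csaScheme_input_eq p h server hinj hI W Z θ ρ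
  have hout : IsOutcome (a ∘ server) 1 (dualMultiplier (a ∘ server) 1) f (W θ) y := by
    refine ⟨A, ν, hA, fun κ => ?_⟩
    have hκ := hy κ
    rw [hinput κ] at hκ
    exact qcsaBox_outcome_eq p h hinj hu _ hκ
  exact IsOutcome.eq h hinj hu (dualMultiplier_ne_zero hα hu) 
    (Classical.epsilon_spec (p := fun w => IsOutcome (a ∘ server) 1
      (dualMultiplier (a ∘ server) 1) f w y) ⟨W θ, hout⟩) hout

end Construction

end QCSA

end

theorem mainTheorem9 (p : ℕ) [Fact p.Prime] (F : Type u) [Field F] [Fintype F] [DecidableEq F]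
    [Algebra (ZMod p) F] (N M K X T : ℕ) (hK : 1 ≤ K) (hI : 2 ≤ X + T + K)
    (hN : X + T + K - 1 < N)
    (hq : N + min (N - (X + T + K - 1)) (X + T + K - 1) ≤ Fintype.card F) :
    ∃ (n L : ℕ) (S : QCSA.Scheme p F N M K X n K (Fin 2 × Fin L)),
      n = L + (X + T + K - 1) ∧
      S.IsMDSCoded ∧ S.IsSecure ∧ S.IsPrivate T ∧ S.IsCorrect ∧ S.IsQCSA ∧
      S.rate = min 1 (2 * (1 - ((X : ℝ) + T + K - 1) / N)) := by
  obtain ⟨I, hIdef⟩ : ∃ I, I = X + T + K - 1 := ⟨_, rfl⟩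
  -- `L ≤ N - I` gives `n ≤ N`, and `L ≤ I` gives `2 * L ≤ n`.
  obtain ⟨L, hLdef⟩ : ∃ L, L = min (N - I) I := ⟨_, rfl⟩
  rw [← hIdef] at hN hq ⊢
  rw [← hLdef] at hq
  obtain ⟨g⟩ : Nonempty (Fin N ⊕ Fin L ↪ F) :=
    Function.Embedding.nonempty_of_card_le (by simpa using hq)
  have hnN : L + I ≤ N := by omega
  have h2L : 2 * L ≤ L + I := by omega
  have haf : Function.Injective (Sum.elim (g ∘ Sum.inl) (g ∘ Sum.inr)) := by
    rw [Sum.elim_comp_inl_inr]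
    exact g.injective
  have hinj : Function.Injective
      (Sum.elim ((g ∘ Sum.inl) ∘ Fin.castLEEmb hnN) (g ∘ Sum.inr : Fin L → F)) := by
    have hcomp : Sum.elim ((g ∘ Sum.inl) ∘ Fin.castLEEmb hnN) (g ∘ Sum.inr : Fin L → F) =
        g ∘ Sum.map (Fin.castLEEmb hnN) id := by
      ext (i | l) <;> rfl
    rw [hcomp]
    exact g.injective.comp ((Fin.castLEEmb hnN).injective.sumMap Function.injective_id)
  have hIn : X + T + K - 1 ≤ L + I - L := by omega
  refine ⟨L + I, L, QCSA.csaScheme p M K X T h2L (Fin.castLEEmb hnN) hinj, rfl,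
    QCSA.csaScheme_isMDSCoded p h2L _ hinj (by omega) fun i j hij => Sum.inl_injective (haf hij),
    QCSA.csaScheme_isSecure p h2L _ hinj haf, QCSA.csaScheme_isPrivate p h2L _ hinj haf,
    QCSA.csaScheme_isCorrect p h2L _ hinj hIn, QCSA.csaScheme_isQCSA p h2L _ hinj hIn, ?_⟩
  have hIreal : (X : ℝ) + T + K - 1 = I := by
    have : X + T + K = I + 1 := by omega
    have : (X : ℝ) + T + K = I + 1 := by exact_mod_cast this
    linarith
  have hKpos : (0 : ℝ) < K := by exact_mod_cast hK
  have hIpos : (0 : ℝ) < I := by exact_mod_cast (show 0 < I by omega)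
  have hNpos : (0 : ℝ) < N := by exact_mod_cast (show 0 < N by omega)
  have hrate : (QCSA.csaScheme p M K X T h2L (Fin.castLEEmb hnN) hinj).rate =
      2 * L / (L + I : ℝ) := by
    rw [QCSA.Scheme.rate]
    simp only [Fintype.card_prod, Fintype.card_fin]
    push_cast
    field_simp
  rw [hrate, hIreal]
  -- Either `L = I`, so that `n = 2 * I` servers suffice for rate `1`, or `L = N - I` and all
  -- servers are queried.
  rcases le_total I (N - I) with hle | hle
  · have hLI : L = I := by omega
    have h2 : (2 * I : ℝ) ≤ N := by exact_mod_cast (show 2 * I ≤ N by omega)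
    rw [hLI, min_eq_left]
    · field_simp
      ring
    · have : (I : ℝ) / N ≤ 1 / 2 := by
        rw [div_le_iff₀ hNpos]
        linarith
      linarith
  · have hLI : (L : ℝ) + I = N := by exact_mod_cast (show L + I = N by omega)
    have h2 : (N : ℝ) ≤ 2 * I := by exact_mod_cast (show N ≤ 2 * I by omega)
    rw [hLI, min_eq_right]
    · rw [← hLI]
      have : (0 : ℝ) < L + I := by rw [hLI]; exact hNpos
      field_simp
      ring
    · have : 1 / 2 ≤ (I : ℝ) / N := by
        rw [le_div_iff₀ hNpos]
        linarith
      linarith
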